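/- Let $\mathbf{k}$ be a field of characteristic $0$; $\otimes$ is over $\mathbf k$, $I$ is the identity and $\tau$ the flip $u\otimes v\mapsto v\otimes u$. **Conformal notions.** On a $\mathbf k[\partial]$-module $P$ consider $\mathbf k$-bilinear maps $P\times P\to P[\lambda]$, $(a,b)\mapsto a_\lambda b$, that are sesquilinear: $(\partial a)_\lambda b=-\lambda\, a_\lambda b$, $a_\lambda(\partial b)=(\partial+\lambda)a_\lambda b$. A *Poisson conformal algebra* $(P,[\cdot_\lambda\cdot],\cdot_\lambda\cdot)$ has two such maps with $[a_\lambda b]=-[b_{-\lambda-\partial}a]$, $[a_\lambda[b_\mu c]]=[[a_\lambda b]_{\lambda+\mu}c]+[b_\mu[a_\lambda c]]$, $a_\lambda b=b_{-\lambda-\partial}a$, $(a_\lambda b)_{\lambda+\mu}c=a_\lambda(b_\mu c)$ and $[a_\lambda(b_\mu c)]=[a_\lambda b]_{\lambda+\mu}c+b_\mu[a_\lambda c]$. A *pre-Poisson conformal algebra* $(P,\circ_\lambda,\succ_\lambda)$ has two such maps with $a\circ_\lambda(b\circ_\mu c)-(a\circ_\lambda b)\circ_{\lambda+\mu}c=b\circ_\mu(a\circ_\lambda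 c)-(b\circ_\mu a)\circ_{\lambda+\mu}c$, $a\succ_\lambda(b\succ_\mu c)=(a\succ_\lambda b+b\succ_{-\lambda-\partial}a)\succ_{\lambda+\mu}c$, $(a\circ_\lambda b-b\circ_{-\lambda-\partial}a)\succ_{\lambda+\mu}c=a\circ_\lambda(b\succ_\mu c)-b\succ_\mu(a\circ_\lambda c)$, $(a\succ_\lambda b+b\succ_{-\lambda-\partial}a)\circ_{\lambda+\mu}c=a\succ_\lambda(b\circ_\mu c)+b\succ_\mu(a\circ_\lambda c)$. A *representation* $(V,\rho,l)$ of a Poisson conformal algebra $P$ consists of a $\mathbf k[\partial]$-module $V$ and $\mathbf k$-bilinear maps $P\times V\to V[\lambda]$, $(a,v)\mapsto\rho(a)_\lambda v$ and $(a,v)\mapsto l(a)_\lambda v$, both sesquilinear (that is, $\mathbf k[\partial]$-module homomorphisms $P\to\mathrm{gc}(V)$), with $\rho([a_\lambda b])_{\lambda+\mu}v=\rho(a)_\lambda(\rho(b)_\mu v)-\rho(b)_\mu(\rho(a)_\lambda v)$, $l(a_\lambda b)_{\lambda+\mu}v=l(a)_\lambda(l(b)_\mu v)$, $\rho(a_\mu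 b)_{-\lambda-\partial}v=l(b)_{-\lambda-\mu-\partial}(\rho(a)_{-\lambda-\partial}v)+l(a)_\mu(\rho(b)_{-\lambda-\partial}v)$, $\rho(a)_\lambda(l(b)_\mu v)=l([a_\lambda b])_{\lambda+\mu}v+l(b)_\mu(\rho(a)_\lambda v)$. The *semi-direct product* $P\ltimes_{\rho,l}V$ is $P\oplus V$ with $[(a+x)_\lambda(b+y)]=[a_\lambda b]+\rho(a)_\lambda y-\rho(b)_{-\lambda-\partial}x$ and $(a+x)_\lambda(b+y)=a_\lambda b+l(a)_\lambda y+l(b)_{-\lambda-\partial}x$. The *conformal dual* is $V^{*c}=\{f:V\to\mathbf k[\lambda]\ \mathbf k\text{-linear}\mid f_\lambda(\partial v)=\lambda f_\lambda(v)\}$ with $(\partial f)_\lambda=-\lambda f_\lambda$, and for $V$ finitely generated over $\mathbf k[\partial]$ the dual $\rho^*$ is defined by $(\rho^*(a)_\lambda f)_\mu v=-f_{\mu-\lambda}(\rho(a)_\lambda v)$. **Bialgebras.** Let $\partial^{\otimes 2}=\partial\otimes I+I\otimes\partial$ and $\partial^{\otimes 3}=\partial\otimes I\otimes I+I\otimes\partial\otimes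 I+I\otimes I\otimes\partial$; write $\mathfrak{ad}(a)_\lambda b=[a_\lambda b]$, $\mathfrak L(a)_\lambda b=a_\lambda b$, $\mathfrak R(a)_\lambda b=b_{-\lambda-\partial}a$. A *Poisson conformal bialgebra* $(P,[\cdot_\lambda\cdot],\cdot_\lambda\cdot,\delta,\Delta)$ is a Poisson conformal algebra with $\mathbf k$-linear maps $\delta,\Delta:P\to P\otimes P$ satisfying $\delta\partial=\partial^{\otimes2}\delta$, $\Delta\partial=\partial^{\otimes2}\Delta$ and, for all $a,b\in P$ and with $\nu=-\lambda-\partial^{\otimes 2}$: (coalgebra) $\delta=-\tau\delta$, $(I\otimes\delta)\delta-(\tau\otimes I)(I\otimes\delta)\delta=(\delta\otimes I)\delta$, $\Delta=\tau\Delta$, $(I\otimes\Delta)\Delta=(\Delta\otimes I)\Delta$, $(I\otimes\Delta)\delta=(\delta\otimes I)\Delta+(\tau\otimes I)(I\otimes\delta)\Delta$; (Lie) $\delta([a_\lambda b])=(\mathfrak{ad}(a)_\lambda\otimes I+I\otimes\mathfrak{ad}(a)_\lambda)\delta(b)-(\mathfrak{ad}(b)_\nu\otimes I+I\otimes\mathfrak{ad}(b)_\nu)\delta(a)$;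 (antisymmetric infinitesimal) $\Delta(a_\lambda b)=(I\otimes\mathfrak L(a)_\lambda)\Delta(b)+(\mathfrak R(b)_\nu\otimes I)\Delta(a)$ and $(\mathfrak L(b)_\nu\otimes I-I\otimes\mathfrak R(b)_\nu)\Delta(a)+\tau(\mathfrak L(a)_\lambda\otimes I-I\otimes\mathfrak R(a)_\lambda)\Delta(b)=0$; (mixed) $\delta(a_\lambda b)=(\mathfrak L(a)_\lambda\otimes I)\delta(b)+(\mathfrak L(b)_\nu\otimes I)\delta(a)+(I\otimes\mathfrak{ad}(a)_\lambda)\Delta(b)+(I\otimes\mathfrak{ad}(b)_\nu)\Delta(a)$ and $\Delta([a_\lambda b])=(\mathfrak{ad}(a)_\lambda\otimes I+I\otimes\mathfrak{ad}(a)_\lambda)\Delta(b)-(I\otimes\mathfrak L(b)_\nu)\delta(a)+(\mathfrak L(b)_\nu\otimes I)\delta(a)$. It is *coboundary* if there is an $r\in P\otimes P$ such that, for all $a$, $$\delta(a)=(\mathfrak{ad}(a)_\lambda\otimes I+I\otimes\mathfrak{ad}(a)_\lambda)r\big|_{\lambda=-\partial^{\otimes2}},\qquad \Delta(a)=(I\otimes\mathfrak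 L(a)_\lambda-\mathfrak L(a)_\lambda\otimes I)r\big|_{\lambda=-\partial^{\otimes2}}.\tag{1}$$ An element $r=\sum_i r_i\otimes l_i\in P\otimes P$ is a *solution of the Poisson conformal Yang–Baxter equation (PCYBE)* in $P$ if both $$\sum_{i,j}\big([{r_i}_\mu r_j]\otimes l_i\otimes l_j|_{\mu=I\otimes\partial\otimes I}-r_i\otimes[{r_j}_\mu l_i]\otimes l_j|_{\mu=I\otimes I\otimes\partial}-r_i\otimes r_j\otimes[{l_j}_\mu l_i]|_{\mu=I\otimes\partial\otimes I}\big)$$ $$\text{and}\quad\sum_{i,j}\big(r_i\otimes r_j\otimes{l_i}_\mu l_j|_{\mu=\partial\otimes I\otimes I}-r_i\otimes{r_j}_\mu l_i\otimes l_j|_{\mu=-\partial^{\otimes2}\otimes I}+{r_i}_\mu r_j\otimes l_i\otimes l_j|_{\mu=I\otimes\partial\otimes I}\big)$$ lie in $\partial^{\otimes3}(P\otimes P\otimes P)$. It is *skew-symmetric* if $\tau r=-r$. **Pre-PGD-algebras.** A *pre-Poisson–Gel'fand–Dorfman algebra (pre-PGD-algebra)* is a $\mathbf k$-vector space $A$ with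 bilinear operations $\lhd,\rhd,\succ,\diamond$ such that for all $a,b,c\in A$, with $a\circ b:=a\lhd b+a\rhd b$, $a\cdot b:=a\succ b+b\succ a$ and $[a,b]:=a\diamond b-b\diamond a$: $a\rhd(b\rhd c)=(a\circ b)\rhd c+b\rhd(a\rhd c)-(b\circ a)\rhd c$; $a\rhd(b\lhd c)=(a\rhd b)\lhd c+b\lhd(a\circ c)-(b\lhd a)\lhd c$; $(a\circ b)\rhd c=(a\rhd c)\lhd b$; $(a\lhd b)\lhd c=(a\lhd c)\lhd b$; $a\succ(b\succ c)=(a\cdot b)\succ c$; $(a\diamond b)\diamond c-a\diamond(b\diamond c)=(b\diamond a)\diamond c-b\diamond(a\diamond c)$; $c\lhd[a,b]-a\diamond(c\lhd b)-(b\diamond c)\lhd a=-b\diamond(c\lhd a)-(a\diamond c)\lhd b$; $[a,b]\rhd c+(a\circ b)\diamond c=a\rhd(b\diamond c)-b\diamond(a\rhd c)+(a\diamond c)\lhd b$; $[a,b]\succ c=a\diamond(b\succ c)-b\succ(a\diamond c)$; $(a\cdot b)\diamond c=a\succ(b\diamond c)+b\succ(a\diamond c)$; $(a\cdot b)\rhd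 c=a\succ(b\rhd c)$; $(a\succ c)\lhd b=a\succ(c\lhd b)=(a\circ b)\succ c$; $a\rhd(b\succ c)=(a\circ b)\succ c+b\succ(a\rhd c)$; $c\lhd(a\cdot b)=b\succ(c\lhd a)+a\succ(c\lhd b)$. **Theorem.** Let $(A,\lhd,\rhd,\succ,\diamond)$ be a finite-dimensional pre-PGD-algebra over $\mathbf k$ and $P=\mathbf k[\partial]\otimes A$, with the sesquilinear maps determined by $$a\circ_\lambda b=\partial(b\lhd a)+\lambda(a\rhd b+b\lhd a)+a\diamond b,\qquad a\succ_\lambda b=a\succ b\qquad(a,b\in A).$$ Then $(P,\circ_\lambda,\succ_\lambda)$ is a pre-Poisson conformal algebra, $P$ is a Poisson conformal algebra under $[a_\lambda b]=a\circ_\lambda b-b\circ_{-\lambda-\partial}a$ and $a_\lambda b=a\succ_\lambda b+b\succ_{-\lambda-\partial}a$, and, with $\mathfrak L_\circ(a)_\lambda b=a\circ_\lambda b$ and $\mathfrak L_\succ(a)_\lambda b=a\succ_\lambda b$, the triple $(P^{*c},\mathfrak L_\circ^*,-\mathfrak L_\succ^*)$ is a representation of it and $\hat P=P\ltimes_{\mathfrak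 L_\circ^*,-\mathfrak L_\succ^*}P^{*c}$ is a Poisson conformal algebra. Let $\{e_1,\dots,e_n\}$ be a basis of $A$ and $\{e_1^*,\dots,e_n^*\}$ the dual basis of $A^*$, where $f\in A^*$ is viewed in $P^{*c}$ as $f_\lambda(p(\partial)a)=p(\lambda)f(a)$. Then $$r=\sum_{i=1}^n(e_i\otimes e_i^*-e_i^*\otimes e_i)\in\hat P\otimes\hat P$$ is a skew-symmetric solution of the PCYBE in $\hat P$. Moreover $\hat P$, with the maps $\delta$ and $\Delta$ defined from this $r$ by (1) for $P$ replaced by $\hat P$, is a (coboundary) Poisson conformal bialgebra. -/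

import Mathlib

open scoped TensorProduct Polynomial

namespace PConf

noncomputable section

/-! ## `k[∂]`-modules and polynomials in `λ` with coefficients in a vector space

A `k[∂]`-module is a module over `k[X]`, the variable `X` being `∂`. -/

/-- The action of `∂` on a `k[∂]`-module, as a `k`-linear map. -/
def del (k V : Type*) [Field k] [AddCommGroup V] [Module k V] [Module k[X] V]
    [IsScalarTower k k[X] V] : Module.End k V :=
  Algebra.lsmul k k V (Polynomial.X : k[X])

section Polys

variable {k : Type*} [Field k]
variable {U V W : Type*} [AddCommGroup U] [Module k U] [AddCommGroup V] [Module k V]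
  [AddCommGroup W] [Module k W]

/-- The space `V[λ]`; the finitely supported sequence `w` stands for `∑ λⁿ wₙ`. -/
abbrev LPoly (V : Type*) [AddCommGroup V] := ℕ →₀ V

/-- Multiplication by `λ` on `V[λ]`. -/
def mulLam (k V : Type*) [Field k] [AddCommGroup V] [Module k V] : Module.End k (LPoly V) :=
  Finsupp.lmapDomain V k (fun n => n + 1)

/-- A linear map applied to the coefficients of a polynomial. -/
def onCoeff (f : V →ₗ[k] W) : LPoly V →ₗ[k] LPoly W := Finsupp.mapRange.linearMap f

/-- The action of `∂` on `V[λ]`. -/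
def delPoly (k V : Type*) [Field k] [AddCommGroup V] [Module k V] [Module k[X] V]
    [IsScalarTower k k[X] V] : Module.End k (LPoly V) :=
  onCoeff (del k V)

/-- The value of `∑ λⁿ wₙ` when the operator `T` is substituted for `λ`, that is `∑ Tⁿ wₙ`. -/
def evalAt (T : Module.End k V) : LPoly V →ₗ[k] V := Finsupp.lsum k (fun n => T ^ n)

/-- The value of `∑ λⁿ wₙ` at the scalar `λ = c`. -/
def evalSc (c : k) : LPoly V →ₗ[k] V := evalAt (c • (1 : Module.End k V))

/-- The substitution `λ ↦ -λ-∂` in `V[λ]`, that is `∑ λⁿ wₙ ↦ ∑ (-λ-∂)ⁿ wₙ`. -/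
def flipLam (k V : Type*) [Field k] [AddCommGroup V] [Module k V] [Module k[X] V]
    [IsScalarTower k k[X] V] : LPoly V →ₗ[k] LPoly V :=
  Finsupp.lsum k (fun n => ((-mulLam k V - delPoly k V) ^ n) ∘ₗ Finsupp.lsingle 0)

/-- Over an infinite field a polynomial with coefficients in a vector space is determined by its
values at scalars. Hence identities of polynomials in several indeterminates `λ, μ, …` may be
stated, as below, by giving these indeterminates arbitrary values in `k`. -/
theorem LPoly.ext_of_evalSc [Infinite k] {w w' : LPoly V}
    (h : ∀ c : k, evalSc c w = evalSc c w') : w = w' := by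
  rw [← sub_eq_zero]
  have h0 : ∀ c : k, evalSc c (w - w') = 0 := fun c => by rw [map_sub, h c, sub_self]
  generalize w - w' = u at h0
  ext n
  rw [Finsupp.coe_zero, Pi.zero_apply, ← Module.forall_dual_apply_eq_zero_iff k]
  intro f
  have hp : (u.sum fun n v => Polynomial.monomial n (f v)) = (0 : k[X]) := by
    refine Polynomial.funext fun c => ?_
    have := congrArg f (h0 c)
    rw [map_zero] at this
    rw [Polynomial.eval_zero, ← this]
    simp [evalSc, evalAt, Finsupp.sum, Polynomial.eval_finsetSum, smul_pow, mul_comm]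
  have := congrArg (fun p => Polynomial.coeff p n) hp
  simp only [Finsupp.sum, Polynomial.finsetSum_coeff, Polynomial.coeff_monomial,
    Polynomial.coeff_zero] at this
  rw [Finset.sum_ite_eq' u.support n] at this
  split_ifs at this with hn
  · exact this
  · rw [Finsupp.notMem_support_iff.mp hn, map_zero]

/-- `f ⊗ I` for a map `f : U → V[λ]`. -/
def onLeft (W : Type*) [AddCommGroup W] [Module k W] (f : U →ₗ[k] LPoly V) :
    U ⊗[k] W →ₗ[k] LPoly (V ⊗[k] W) :=
  (TensorProduct.finsuppLeft k k V W ℕ).toLinearMap ∘ₗ LinearMap.rTensor W f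

/-- `I ⊗ f` for a map `f : U → V[λ]`. -/
def onRight (W : Type*) [AddCommGroup W] [Module k W] (f : U →ₗ[k] LPoly V) :
    W ⊗[k] U →ₗ[k] LPoly (W ⊗[k] V) :=
  (TensorProduct.finsuppRight k k W V ℕ).toLinearMap ∘ₗ LinearMap.lTensor W f

theorem onLeft_tmul (f : U →ₗ[k] LPoly V) (u : U) (w : W) :
    onLeft W f (u ⊗ₜ w) = onCoeff ((TensorProduct.mk k V W).flip w) (f u) := by
  ext n
  simp [onLeft, onCoeff, TensorProduct.finsuppLeft_apply_tmul_apply]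

theorem onRight_tmul (f : U →ₗ[k] LPoly V) (u : U) (w : W) :
    onRight W f (w ⊗ₜ u) = onCoeff (TensorProduct.mk k W V w) (f u) := by
  ext n
  simp [onRight, onCoeff, TensorProduct.finsuppRight_apply_tmul_apply]

theorem mulLam_single (n : ℕ) (v : V) :
    mulLam k V (Finsupp.single n v) = Finsupp.single (n + 1) v := by
  simp [mulLam]

theorem evalAt_single (T : Module.End k V) (n : ℕ) (v : V) :
    evalAt T (Finsupp.single n v) = (T ^ n) v := by
  simp [evalAt]

theorem evalSc_mulLam (c : k) (w : LPoly V) : evalSc c (mulLam k V w) = c • evalSc c w := by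
  induction w using Finsupp.induction_linear with
  | zero => simp
  | add f g hf hg => simp only [map_add, hf, hg, smul_add]
  | single n v => simp [mulLam_single, evalSc, evalAt_single, pow_succ']

variable [Module k[X] V] [IsScalarTower k k[X] V]

theorem evalSc_delPoly (c : k) (w : LPoly V) :
    evalSc c (delPoly k V w) = del k V (evalSc c w) := by
  induction w using Finsupp.induction_linear with
  | zero => simp
  | add f g hf hg => simp only [map_add, hf, hg]
  | single n v => simp [delPoly, onCoeff, evalSc, evalAt_single, smul_pow]

/-- Substituting `-λ-∂` for `λ` and then the scalar `c` for `λ` is substituting `-c-∂`. -/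
theorem evalSc_flipLam (c : k) (w : LPoly V) :
    evalSc c (flipLam k V w) = evalAt (-(c • (1 : Module.End k V)) - del k V) w := by
  induction w using Finsupp.induction_linear with
  | zero => simp
  | add f g hf hg => simp only [map_add, hf, hg]
  | single n v =>
    have key : ∀ w : LPoly V, evalSc c ((-mulLam k V - delPoly k V) w)
        = (-(c • (1 : Module.End k V)) - del k V) (evalSc c w) := by
      intro w
      simp [evalSc_mulLam, evalSc_delPoly]
    have key2 : ∀ (n : ℕ) (w : LPoly V), evalSc c (((-mulLam k V - delPoly k V) ^ n) w)
        = ((-(c • (1 : Module.End k V)) - del k V) ^ n) (evalSc c w) := by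
      intro n
      induction n with
      | zero => intro w; simp
      | succ n ih => intro w; rw [pow_succ, pow_succ, Module.End.mul_apply, Module.End.mul_apply,
          ih, key]
    rw [evalAt_single]
    simp [flipLam, key2]
    simp [evalSc, evalAt_single]

end Polys

/-! ## Products with values in polynomials, conformal algebras and their representations -/

section Algebras

variable {k : Type*} [Field k]
variable {P V : Type*}
  [AddCommGroup P] [Module k P] [Module k[X] P] [IsScalarTower k k[X] P]
  [AddCommGroup V] [Module k V] [Module k[X] V] [IsScalarTower k k[X] V]

/-- `k`-bilinear maps `P × V → V[λ]`, `(a, v) ↦ ρ(a)_λ v`. For `V = P` these are the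
`λ`-products (or `λ`-brackets) on `P`. -/
abbrev LAct (k P V : Type*) [Field k] [AddCommGroup P] [Module k P] [AddCommGroup V]
    [Module k V] := P →ₗ[k] V →ₗ[k] LPoly V

/-- `(∂a)_λ v = -λ a_λ v` and `a_λ (∂v) = (∂+λ) a_λ v`. For a `λ`-product on `P` this is conformal
sesquilinearity; for a general `ρ` it says that `ρ` is a `k[∂]`-module homomorphism
from `P` to `gc(V)`. -/
structure Sesqui (ρ : LAct k P V) : Prop where
  left : ∀ a v, ρ (del k P a) v = -mulLam k V (ρ a v)
  right : ∀ a v, ρ a (del k V v) = delPoly k V (ρ a v) + mulLam k V (ρ a v)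

/-- `ρ(a)_c v` for a scalar `c`. -/
def lm (ρ : LAct k P V) (c : k) (a : P) (v : V) : V := evalSc c (ρ a v)

/-- `ρ(a)_{-c-∂} v` for a scalar `c`. -/
def lmNeg (ρ : LAct k P V) (c : k) (a : P) (v : V) : V := evalSc c (flipLam k V (ρ a v))

/-- The opposite of a `λ`-product: `(a, b) ↦ b_{-λ-∂} a`. -/
def opp (β : LAct k P P) : LAct k P P := β.flip.compr₂ (flipLam k P)

structure IsAssocConf (β : LAct k P P) : Prop where
  sesqui : Sesqui β
  assoc : ∀ (l m : k) (a b c : P), lm β (l + m) (lm β l a b) c = lm β l a (lm β m b c)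

/-- `a_λ b = b_{-λ-∂} a`. -/
def IsCommConf (β : LAct k P P) : Prop := ∀ a b : P, β a b = opp β a b

structure IsLieConf (β : LAct k P P) : Prop where
  sesqui : Sesqui β
  skew : ∀ a b : P, β a b = -opp β a b
  jacobi : ∀ (l m : k) (a b c : P),
    lm β l a (lm β m b c) = lm β (l + m) (lm β l a b) c + lm β m b (lm β l a c)

/-- Poisson conformal algebras, with bracket `br` and commutative product `mu`. -/
structure IsPoissonConf (br mu : LAct k P P) : Prop where
  lie : IsLieConf br
  assoc : IsAssocConf mu
  comm : IsCommConf mu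
  leibniz : ∀ (l m : k) (a b c : P),
    lm br l a (lm mu m b c) = lm mu (l + m) (lm br l a b) c + lm mu m b (lm br l a c)

structure IsLieRep (br : LAct k P P) (ρ : LAct k P V) : Prop where
  sesqui : Sesqui ρ
  rep : ∀ (l m : k) (a b : P) (v : V),
    lm ρ (l + m) (lm br l a b) v = lm ρ l a (lm ρ m b v) - lm ρ m b (lm ρ l a v)

structure IsCommAssocRep (mu : LAct k P P) (τ : LAct k P V) : Prop where
  sesqui : Sesqui τ
  rep : ∀ (l m : k) (a b : P) (v : V),
    lm τ (l + m) (lm mu l a b) v = lm τ l a (lm τ m b v)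

/-- Representations `(V, ρ, τ)` of a Poisson conformal algebra `(P, br, mu)`. -/
structure IsPoissonRep (br mu : LAct k P P) (ρ τ : LAct k P V) : Prop where
  lie : IsLieRep br ρ
  assoc : IsCommAssocRep mu τ
  compat₁ : ∀ (l m : k) (a b : P) (v : V),
    lmNeg ρ l (lm mu m a b) v
      = lmNeg τ (l + m) b (lmNeg ρ l a v) + lm τ m a (lmNeg ρ l b v)
  compat₂ : ∀ (l m : k) (a b : P) (v : V),
    lm ρ l a (lm τ m b v) = lm τ (l + m) (lm br l a b) v + lm τ m b (lm ρ l a v)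

structure IsLeftSymmConf (β : LAct k P P) : Prop where
  sesqui : Sesqui β
  leftSymm : ∀ (l m : k) (a b c : P),
    lm β l a (lm β m b c) - lm β (l + m) (lm β l a b) c
      = lm β m b (lm β l a c) - lm β (l + m) (lm β m b a) c

structure IsZinbielConf (β : LAct k P P) : Prop where
  sesqui : Sesqui β
  zinbiel : ∀ (l m : k) (a b c : P),
    lm β l a (lm β m b c) = lm β (l + m) (lm β l a b + lmNeg β l b a) c

/-- Pre-Poisson conformal algebras `(P, ∘_λ, ≻_λ)`, with `∘ = ci` and `≻ = su`. -/
structure IsPrePoissonConf (ci su : LAct k P P) : Prop where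
  zinbiel : IsZinbielConf su
  leftSymm : IsLeftSymmConf ci
  compat₁ : ∀ (l m : k) (a b c : P),
    lm su (l + m) (lm ci l a b - lmNeg ci l b a) c
      = lm ci l a (lm su m b c) - lm su m b (lm ci l a c)
  compat₂ : ∀ (l m : k) (a b c : P),
    lm ci (l + m) (lm su l a b + lmNeg su l b a) c
      = lm su l a (lm ci m b c) + lm su m b (lm ci l a c)

/-- The bracket `[a_λ b] = a ∘_λ b - b ∘_{-λ-∂} a`. -/
def commutatorBr (ci : LAct k P P) : LAct k P P := ci - opp ci

/-- The product `a_λ b = a ≻_λ b + b ≻_{-λ-∂} a`. -/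
def symmMul (su : LAct k P P) : LAct k P P := su + opp su

/-- The bracket of a semi-direct product on `P ⊕ V`:
`[(a+x)_λ (b+y)] = [a_λ b] + ρ(a)_λ y - ρ(b)_{-λ-∂} x`. -/
def semiBr (br : LAct k P P) (ρ : LAct k P V) : LAct k (P × V) (P × V) :=
  LinearMap.mk₂ k
    (fun p q => onCoeff (LinearMap.inl k P V) (br p.1 q.1)
      + onCoeff (LinearMap.inr k P V) (ρ p.1 q.2 - flipLam k V (ρ q.1 p.2)))
    (by intro p p' q; simp only [Prod.fst_add, Prod.snd_add, map_add, LinearMap.add_apply, map_sub]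
        abel)
    (by intro c p q; simp only [Prod.smul_fst, Prod.smul_snd, map_smul, LinearMap.smul_apply,
          map_sub, smul_add, smul_sub])
    (by intro p q q'; simp only [Prod.fst_add, Prod.snd_add, map_add, LinearMap.add_apply, map_sub]
        abel)
    (by intro c p q; simp only [Prod.smul_fst, Prod.smul_snd, map_smul, LinearMap.smul_apply,
          map_sub, smul_add, smul_sub])

/-- The commutative product of a semi-direct product on `P ⊕ V`:
`(a+x)_λ (b+y) = a_λ b + τ(a)_λ y + τ(b)_{-λ-∂} x`. -/
def semiMul (mu : LAct k P P) (τ : LAct k P V) : LAct k (P × V) (P × V) :=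
  LinearMap.mk₂ k
    (fun p q => onCoeff (LinearMap.inl k P V) (mu p.1 q.1)
      + onCoeff (LinearMap.inr k P V) (τ p.1 q.2 + flipLam k V (τ q.1 p.2)))
    (by intro p p' q; simp only [Prod.fst_add, Prod.snd_add, map_add, LinearMap.add_apply]
        abel)
    (by intro c p q; simp only [Prod.smul_fst, Prod.smul_snd, map_smul, LinearMap.smul_apply,
          map_add, smul_add])
    (by intro p q q'; simp only [Prod.fst_add, Prod.snd_add, map_add, LinearMap.add_apply]
        abel)
    (by intro c p q; simp only [Prod.smul_fst, Prod.smul_snd, map_smul, LinearMap.smul_apply,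
          map_add, smul_add])

end Algebras

/-! ## The conformal dual -/

section Dual

variable {k : Type*} [Field k]
variable {P V : Type*}
  [AddCommGroup P] [Module k P]
  [AddCommGroup V] [Module k V] [Module k[X] V] [IsScalarTower k k[X] V]

/-- The conformal dual `{f : V → k[λ] | f_λ(∂v) = λ f_λ(v)}`, as a `k`-vector space. -/
def confDualSub (k V : Type*) [Field k] [AddCommGroup V] [Module k V] [Module k[X] V]
    [IsScalarTower k k[X] V] : Submodule k (V →ₗ[k] k[X]) where
  carrier := {f | ∀ v, f (del k V v) = Polynomial.X * f v}
  add_mem' := by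
    intro f g hf hg v
    simp only [LinearMap.add_apply, hf v, hg v, mul_add]
  zero_mem' := by intro v; simp
  smul_mem' := by
    intro c f hf v
    simp only [LinearMap.smul_apply, hf v, mul_smul_comm]

/-- The conformal dual of a `k[∂]`-module. -/
def ConfDual (k V : Type*) [Field k] [AddCommGroup V] [Module k V] [Module k[X] V]
    [IsScalarTower k k[X] V] : Type _ := confDualSub k V

instance : AddCommGroup (ConfDual k V) := inferInstanceAs (AddCommGroup (confDualSub k V))

instance : Module k (ConfDual k V) := inferInstanceAs (Module k (confDualSub k V))

/-- The underlying linear map `f_λ : V → k[λ]` of an element of the conformal dual. -/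
def ConfDual.toLin : ConfDual k V →ₗ[k] V →ₗ[k] k[X] := (confDualSub k V).subtype

theorem ConfDual.ext {f g : ConfDual k V} (h : ∀ v, f.toLin v = g.toLin v) : f = g :=
  Subtype.ext (LinearMap.ext h)

theorem ConfDual.toLin_del (f : ConfDual k V) (v : V) :
    f.toLin (del k V v) = Polynomial.X * f.toLin v := f.2 v

/-- An element of the conformal dual from a linear map with `f_λ(∂v) = λ f_λ(v)`. -/
def ConfDual.mk (f : V →ₗ[k] k[X]) (hf : ∀ v, f (del k V v) = Polynomial.X * f v) :
    ConfDual k V := ⟨f, hf⟩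

theorem ConfDual.toLin_mk (f : V →ₗ[k] k[X])
    (hf : ∀ v, f (del k V v) = Polynomial.X * f v) : (ConfDual.mk f hf).toLin = f := rfl

/-- `p(∂)` acts on the conformal dual by `(p(∂) f)_λ = p(-λ) f_λ`; in particular
`(∂f)_λ = -λ f_λ`. -/
instance : SMul k[X] (ConfDual k V) where
  smul p f := ConfDual.mk ((LinearMap.mulLeft k (p.comp (-Polynomial.X))) ∘ₗ f.toLin) (by
    intro v
    simp only [LinearMap.comp_apply, f.toLin_del v, LinearMap.mulLeft_apply]
    ring)

theorem ConfDual.smul_apply (p : k[X]) (f : ConfDual k V) (v : V) :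
    (p • f).toLin v = p.comp (-Polynomial.X) * f.toLin v := rfl

instance : Module k[X] (ConfDual k V) where
  one_smul f := by apply ConfDual.ext; intro v; simp [ConfDual.smul_apply]
  mul_smul p q f := by apply ConfDual.ext; intro v; simp [ConfDual.smul_apply, mul_assoc]
  smul_zero p := by apply ConfDual.ext; intro v; simp [ConfDual.smul_apply]
  smul_add p f g := by apply ConfDual.ext; intro v; simp [ConfDual.smul_apply, mul_add]
  add_smul p q f := by apply ConfDual.ext; intro v; simp [ConfDual.smul_apply, add_mul]
  zero_smul f := by apply ConfDual.ext; intro v; simp [ConfDual.smul_apply]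

instance : IsScalarTower k k[X] (ConfDual k V) where
  smul_assoc c p f := by
    apply ConfDual.ext; intro v
    simp [ConfDual.smul_apply]

theorem ConfDual.del_apply (f : ConfDual k V) (v : V) :
    (del k (ConfDual k V) f).toLin v = -(Polynomial.X * f.toLin v) := by
  change (Polynomial.X : k[X]).comp (-Polynomial.X) * f.toLin v = _
  simp

/-- For fixed `a` and `f`, the map `v ↦ f_{μ-λ}(ρ(a)_λ v)` with values in `k[μ][λ]`. -/
def dualPoly (ρ : LAct k P V) (a : P) (f : ConfDual k V) : V →ₗ[k] k[X][X] :=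
  Finsupp.lsum k (fun n => LinearMap.mulLeft k ((Polynomial.X : k[X][X]) ^ n)
    ∘ₗ ((Polynomial.aeval (Polynomial.C Polynomial.X - Polynomial.X : k[X][X])).toLinearMap
    ∘ₗ f.toLin)) ∘ₗ ρ a

theorem dualPoly_apply (ρ : LAct k P V) (a : P) (f : ConfDual k V) (v : V) :
    dualPoly ρ a f v = (ρ a v).sum fun n w => Polynomial.X ^ n
      * Polynomial.aeval (Polynomial.C Polynomial.X - Polynomial.X : k[X][X]) (f.toLin w) := rfl

theorem dualPoly_add_left (ρ : LAct k P V) (a b : P) (f : ConfDual k V) :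
    dualPoly ρ (a + b) f = dualPoly ρ a f + dualPoly ρ b f := by
  rw [dualPoly, map_add, LinearMap.comp_add]; rfl

theorem dualPoly_smul_left (ρ : LAct k P V) (c : k) (a : P) (f : ConfDual k V) :
    dualPoly ρ (c • a) f = c • dualPoly ρ a f := by
  rw [dualPoly, map_smul, LinearMap.comp_smul]; rfl

theorem dualPoly_add_right (ρ : LAct k P V) (a : P) (f g : ConfDual k V) :
    dualPoly ρ a (f + g) = dualPoly ρ a f + dualPoly ρ a g := by
  ext1 v
  simp only [dualPoly_apply, LinearMap.add_apply, map_add, mul_add, Finsupp.sum_add]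

theorem dualPoly_smul_right (ρ : LAct k P V) (c : k) (a : P) (f : ConfDual k V) :
    dualPoly ρ a (c • f) = c • dualPoly ρ a f := by
  ext1 v
  simp only [dualPoly_apply, LinearMap.smul_apply, map_smul, mul_smul_comm, Finsupp.smul_sum]

variable [Module k[X] P] [IsScalarTower k k[X] P]

theorem dualPoly_del {ρ : LAct k P V} (hρ : Sesqui ρ) (a : P) (f : ConfDual k V) (v : V) :
    dualPoly ρ a f (del k V v) = Polynomial.C Polynomial.X * dualPoly ρ a f v := by
  rw [dualPoly, LinearMap.comp_apply, LinearMap.comp_apply, hρ.right]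
  generalize ρ a v = w
  induction w using Finsupp.induction_linear with
  | zero => simp only [map_zero, mul_zero, add_zero]
  | add f g hf hg => simp only [map_add, mul_add] at hf hg ⊢; rw [← hf, ← hg]; abel
  | single n v =>
    rw [map_add, mulLam_single, delPoly, onCoeff, Finsupp.mapRange.linearMap_apply,
      Finsupp.mapRange_single, Finsupp.lsum_single, Finsupp.lsum_single, Finsupp.lsum_single]
    simp only [LinearMap.comp_apply, LinearMap.mulLeft_apply, AlgHom.toLinearMap_apply,
      f.toLin_del, map_mul, Polynomial.aeval_X]
    ring

theorem dualPoly_smul {ρ : LAct k P V} (hρ : Sesqui ρ) (a : P) (f : ConfDual k V) (p : k[X])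
    (v : V) : dualPoly ρ a f (p • v) = Polynomial.C p * dualPoly ρ a f v := by
  induction p using Polynomial.induction_on' generalizing v with
  | add p q hp hq => rw [add_smul, map_add, hp, hq, map_add, add_mul]
  | monomial n c =>
    induction n generalizing v with
    | zero =>
      have h1 : (Polynomial.monomial 0 c : k[X]) = c • (1 : k[X]) := by
        rw [Polynomial.smul_eq_C_mul, mul_one, Polynomial.monomial_zero_left]
      rw [h1, smul_assoc, one_smul, map_smul, ← Polynomial.smul_eq_C_mul, smul_assoc, one_smul]
    | succ n ih =>
      rw [← Polynomial.monomial_mul_X, mul_smul, ih,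
        show (Polynomial.X : k[X]) • v = del k V v from rfl, dualPoly_del hρ, map_mul, mul_assoc]

/-- The coefficient of `λᵐ` in `f_{μ-λ}(ρ(a)_λ v)`, as an element of the conformal dual. -/
def dualCoeff {ρ : LAct k P V} (hρ : Sesqui ρ) (a : P) (f : ConfDual k V) (m : ℕ) :
    ConfDual k V :=
  ConfDual.mk ((Polynomial.lcoeff k[X] m).restrictScalars k ∘ₗ dualPoly ρ a f) (by
    intro v
    simp [dualPoly_del hρ])

theorem dualCoeff_apply {ρ : LAct k P V} (hρ : Sesqui ρ) (a : P) (f : ConfDual k V) (m : ℕ)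
    (v : V) : (dualCoeff hρ a f m).toLin v = (dualPoly ρ a f v).coeff m := rfl

theorem dualCoeff_finite [Module.Finite k[X] V] {ρ : LAct k P V} (hρ : Sesqui ρ) (a : P)
    (f : ConfDual k V) : ((fun m => dualCoeff hρ a f m).support).Finite := by
  obtain ⟨s, hs⟩ := (Module.Finite.fg_top : (⊤ : Submodule k[X] V).FG)
  refine (Set.finite_le_nat (s.sup fun v => (dualPoly ρ a f v).natDegree)).subset ?_
  intro m hm
  by_contra hlt
  refine hm (ConfDual.ext fun v => ?_)
  rw [dualCoeff_apply, map_zero, LinearMap.zero_apply]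
  have hv : v ∈ Submodule.span k[X] (s : Set V) := by rw [hs]; trivial
  induction hv using Submodule.span_induction with
  | mem x hx =>
    refine Polynomial.coeff_eq_zero_of_natDegree_lt ?_
    exact lt_of_le_of_lt (Finset.le_sup (f := fun v => (dualPoly ρ a f v).natDegree) hx)
      (not_le.mp hlt)
  | zero => rw [map_zero, Polynomial.coeff_zero]
  | add x y _ _ hx hy => rw [map_add, Polynomial.coeff_add, hx, hy, add_zero]
  | smul p x _ hx => rw [dualPoly_smul hρ, Polynomial.coeff_C_mul, hx, mul_zero]

/-- The dual `ρ*` of a `k[∂]`-module homomorphism `ρ : P → gc(V)`, given by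
`(ρ*(a)_λ f)_μ v = -f_{μ-λ}(ρ(a)_λ v)`. Finiteness of `V` makes this polynomial in `λ`. -/
def dualAct [Module.Finite k[X] V] {ρ : LAct k P V} (hρ : Sesqui ρ) :
    LAct k P (ConfDual k V) :=
  LinearMap.mk₂ k
    (fun a f => -Finsupp.ofSupportFinite (fun m => dualCoeff hρ a f m) (dualCoeff_finite hρ a f))
    (by
      intro a b f; ext m; apply ConfDual.ext; intro v
      simp [Finsupp.ofSupportFinite_coe, dualCoeff_apply, dualPoly_add_left, add_comm])
    (by
      intro c a f; ext m; apply ConfDual.ext; intro v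
      simp [Finsupp.ofSupportFinite_coe, dualCoeff_apply, dualPoly_smul_left])
    (by
      intro a f g; ext m; apply ConfDual.ext; intro v
      simp [Finsupp.ofSupportFinite_coe, dualCoeff_apply, dualPoly_add_right, add_comm])
    (by
      intro c a f; ext m; apply ConfDual.ext; intro v
      simp [Finsupp.ofSupportFinite_coe, dualCoeff_apply, dualPoly_smul_right])

theorem dualAct_coeff [Module.Finite k[X] V] {ρ : LAct k P V} (hρ : Sesqui ρ) (a : P)
    (f : ConfDual k V) (m : ℕ) (v : V) :
    (dualAct hρ a f m).toLin v = -(dualPoly ρ a f v).coeff m := by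
  simp [dualAct, Finsupp.ofSupportFinite_coe, dualCoeff_apply]

/-- The defining formula `(ρ*(a)_c f)_d v = -f_{d-c}(ρ(a)_c v)`. -/
theorem dualAct_apply [Module.Finite k[X] V] {ρ : LAct k P V} (hρ : Sesqui ρ) (a : P)
    (f : ConfDual k V) (v : V) (c d : k) :
    ((lm (dualAct hρ) c a f).toLin v).eval d = -(f.toLin (lm ρ c a v)).eval (d - c) := by
  have h1 : ∀ w : LPoly (ConfDual k V), ∀ N, w.support ⊆ Finset.range N →
      ((evalSc c w).toLin v).eval d
        = ∑ m ∈ Finset.range N, c ^ m * ((w m).toLin v).eval d := by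
    intro w N hN
    simp only [evalSc, evalAt, Finsupp.coe_lsum, smul_pow, one_pow]
    rw [Finsupp.sum_of_support_subset _ hN _ (by simp)]
    simp [LinearMap.sum_apply, Polynomial.eval_finsetSum]
  have h2 : ∀ q : k[X][X], ∀ N, q.natDegree < N →
      (q.eval (Polynomial.C c)).eval d = ∑ m ∈ Finset.range N, c ^ m * (q.coeff m).eval d := by
    intro q N hN
    rw [Polynomial.eval_eq_sum_range' hN, Polynomial.eval_finsetSum]
    refine Finset.sum_congr rfl fun m _ => ?_
    simp [mul_comm]
  have h3 : ((dualPoly ρ a f v).eval (Polynomial.C c)).eval d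
      = (f.toLin (lm ρ c a v)).eval (d - c) := by
    have key : ∀ q : k[X], ((Polynomial.aeval (Polynomial.C Polynomial.X - Polynomial.X : k[X][X])
        q).eval (Polynomial.C c)).eval d = q.eval (d - c) := by
      intro q
      induction q using Polynomial.induction_on' with
      | add p q hp hq => simp only [map_add, Polynomial.eval_add, hp, hq]
      | monomial n e => simp [Polynomial.aeval_monomial]
    rw [dualPoly_apply, lm, evalSc, evalAt]
    simp [Finsupp.sum, Polynomial.eval_finsetSum, key, smul_pow]
  obtain ⟨N, hN⟩ := (dualAct hρ a f).support.exists_nat_subset_range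
  rw [lm, h1 _ (max N ((dualPoly ρ a f v).natDegree + 1)) (hN.trans (by simp)),
    ← h3, h2 _ (max N ((dualPoly ρ a f v).natDegree + 1)) (by simp), ← Finset.sum_neg_distrib]
  refine Finset.sum_congr rfl fun m _ => ?_
  rw [dualAct_coeff, Polynomial.eval_neg, mul_neg]

end Dual

/-! ## Pre-Poisson-Gel'fand-Dorfman algebras -/

section PrePGD

variable {k : Type*} [Field k] {A : Type*} [AddCommGroup A] [Module k A]

/-- Pre-Novikov algebras `(A, ◁, ▷)`. -/
structure IsPreNovikov (lhd rhd : A →ₗ[k] A →ₗ[k] A) : Prop where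
  nd₁ : ∀ a b c, rhd a (rhd b c)
    = rhd (rhd a b + lhd a b) c + rhd b (rhd a c) - rhd (rhd b a + lhd b a) c
  nd₂ : ∀ a b c, rhd a (lhd b c)
    = lhd (rhd a b) c + lhd b (lhd a c + rhd a c) - lhd (lhd b a) c
  nd₃ : ∀ a b c, rhd (lhd a b + rhd a b) c = lhd (rhd a c) b
  nd₄ : ∀ a b c, lhd (lhd a b) c = lhd (lhd a c) b

/-- Zinbiel algebras `(A, ≻)`. -/
def IsZinbiel (su : A →ₗ[k] A →ₗ[k] A) : Prop :=
  ∀ a b c, su a (su b c) = su (su b a + su a b) c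

/-- Left-symmetric algebras `(A, ◇)`. -/
def IsLeftSymm (dia : A →ₗ[k] A →ₗ[k] A) : Prop :=
  ∀ a b c, dia (dia a b) c - dia a (dia b c) = dia (dia b a) c - dia b (dia a c)

/-- Pre-Gel'fand-Dorfman algebras `(A, ◁, ▷, ◇)`. -/
structure IsPreGD (lhd rhd dia : A →ₗ[k] A →ₗ[k] A) : Prop where
  preNovikov : IsPreNovikov lhd rhd
  leftSymm : IsLeftSymm dia
  compat₁ : ∀ a b c, lhd c (dia a b - dia b a) - dia a (lhd c b) - lhd (dia b c) a
    = -dia b (lhd c a) - lhd (dia a c) b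
  compat₂ : ∀ a b c, rhd (dia a b - dia b a) c + dia (lhd a b + rhd a b) c
    = rhd a (dia b c) - dia b (rhd a c) + lhd (dia a c) b

/-- Pre-Poisson algebras `(A, ◇, ≻)`. -/
structure IsPrePoisson (dia su : A →ₗ[k] A →ₗ[k] A) : Prop where
  leftSymm : IsLeftSymm dia
  zinbiel : IsZinbiel su
  compat₁ : ∀ a b c, su (dia a b - dia b a) c = dia a (su b c) - su b (dia a c)
  compat₂ : ∀ a b c, dia (su a b + su b a) c = su a (dia b c) + su b (dia a c)

/-- Pre-differential Novikov-Poisson algebras `(A, ◁, ▷, ≻)`. -/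
structure IsPreDNP (lhd rhd su : A →ₗ[k] A →ₗ[k] A) : Prop where
  preNovikov : IsPreNovikov lhd rhd
  zinbiel : IsZinbiel su
  compat₁ : ∀ a b c, rhd (su a b + su b a) c = su a (rhd b c)
  compat₂ : ∀ a b c, lhd (su a c) b = su a (lhd c b)
  compat₃ : ∀ a b c, su a (lhd c b) = su (lhd a b + rhd a b) c
  compat₄ : ∀ a b c, rhd a (su b c) = su (lhd a b + rhd a b) c + su b (rhd a c)
  compat₅ : ∀ a b c, lhd c (su a b + su b a) = su b (lhd c a) + su a (lhd c b)

/-- Pre-Poisson-Gel'fand-Dorfman algebras (pre-PGD-algebras) `(A, ◁, ▷, ≻, ◇)`. -/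
structure IsPrePGD (lhd rhd su dia : A →ₗ[k] A →ₗ[k] A) : Prop where
  preDNP : IsPreDNP lhd rhd su
  preGD : IsPreGD lhd rhd dia
  prePoisson : IsPrePoisson dia su

end PrePGD

/-! ## The free `k[∂]`-module on a vector space -/

section Free

variable {k : Type*} [Field k] {A : Type*} [AddCommGroup A] [Module k A]

/-- `P = k[∂] ⊗ A`. -/
abbrev FreeMod (k A : Type*) [Field k] [AddCommGroup A] [Module k A] := k[X] ⊗[k] A

/-- The inclusion `A → k[∂] ⊗ A`, `a ↦ 1 ⊗ a`. -/
def inA (k A : Type*) [Field k] [AddCommGroup A] [Module k A] : A →ₗ[k] FreeMod k A :=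
  TensorProduct.mk k k[X] A 1

/-- The extension of a bilinear map `A × A → P[λ]` to `P = k[∂] ⊗ A` by conformal
sesquilinearity: `(p(∂)a)_λ (q(∂)b) = p(-λ) q(∂+λ) (a_λ b)`. -/
def extendProd (φ : A →ₗ[k] A →ₗ[k] LPoly (FreeMod k A)) : LAct k (FreeMod k A) (FreeMod k A) :=
  TensorProduct.curry
    (TensorProduct.lift
      ((TensorProduct.lift
        ((LinearMap.mul k (Module.End k (LPoly (FreeMod k A)))).compl₁₂
          (Polynomial.aeval (-mulLam k (FreeMod k A))).toLinearMap
          (Polynomial.aeval (delPoly k (FreeMod k A) + mulLam k (FreeMod k A))).toLinearMap)).compl₂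
        (TensorProduct.lift φ))
      ∘ₗ (TensorProduct.tensorTensorTensorComm k k[X] A k[X] A).toLinearMap)

theorem extendProd_tmul (φ : A →ₗ[k] A →ₗ[k] LPoly (FreeMod k A)) (p q : k[X]) (a b : A) :
    extendProd φ (p ⊗ₜ a) (q ⊗ₜ b)
      = Polynomial.aeval (-mulLam k (FreeMod k A)) p
          (Polynomial.aeval (delPoly k (FreeMod k A) + mulLam k (FreeMod k A)) q (φ a b)) := by
  simp [extendProd]

theorem commute_del_mul (V : Type*) [AddCommGroup V] [Module k V] [Module k[X] V]
    [IsScalarTower k k[X] V] : Commute (delPoly k V) (mulLam k V) := by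
  refine LinearMap.ext fun w => ?_
  induction w using Finsupp.induction_linear with
  | zero => simp
  | add f g hf hg => simp only [map_add, hf, hg]
  | single n v => simp [mulLam_single, delPoly, onCoeff]

theorem commute_aeval (V : Type*) [AddCommGroup V] [Module k V] [Module k[X] V]
    [IsScalarTower k k[X] V] (p : k[X]) :
    Commute (Polynomial.aeval (-mulLam k V) p) (delPoly k V + mulLam k V) := by
  have h1 : Commute (-mulLam k V) (delPoly k V + mulLam k V) :=
    (((commute_del_mul V).add_left (Commute.refl _)).neg_right).symm
  induction p using Polynomial.induction_on' with
  | add p q hp hq => rw [map_add]; exact hp.add_left hq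
  | monomial n c =>
    rw [Polynomial.aeval_monomial]
    exact Commute.mul_left (Algebra.commutes c (delPoly k V + mulLam k V)) (h1.pow_left n)

theorem del_tmul (p : k[X]) (a : A) :
    del k (FreeMod k A) (p ⊗ₜ a) = (Polynomial.X * p) ⊗ₜ a := rfl

theorem extendProd_sesqui (φ : A →ₗ[k] A →ₗ[k] LPoly (FreeMod k A)) : Sesqui (extendProd φ) where
  left x y := by
    induction x using TensorProduct.induction_on with
    | zero => simp
    | add x x' hx hx' => simp only [map_add, LinearMap.add_apply, hx, hx', neg_add]
    | tmul p a =>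
      induction y using TensorProduct.induction_on with
      | zero => simp
      | add y y' hy hy' => simp only [map_add, hy, hy', neg_add]
      | tmul q b =>
        rw [del_tmul, extendProd_tmul, extendProd_tmul, map_mul, Polynomial.aeval_X,
          Module.End.mul_apply, LinearMap.neg_apply]
  right x y := by
    induction x using TensorProduct.induction_on with
    | zero => simp
    | add x x' hx hx' => simp only [map_add, LinearMap.add_apply, hx, hx']; abel
    | tmul p a =>
      induction y using TensorProduct.induction_on with
      | zero => simp
      | add y y' hy hy' => simp only [map_add, hy, hy']; abel
      | tmul q b =>
        have hc := commute_aeval (FreeMod k A) p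
        rw [del_tmul, extendProd_tmul, extendProd_tmul, map_mul, Polynomial.aeval_X,
          Module.End.mul_apply, ← Module.End.mul_apply, hc.eq, Module.End.mul_apply,
          LinearMap.add_apply]

/-- The `λ`-product on `k[∂] ⊗ A` with
`a ∘_λ b = ∂(b ◁ a) + λ(a ▷ b + b ◁ a) + a ◇ b` for `a, b ∈ A`. -/
def circProd (lhd rhd dia : A →ₗ[k] A →ₗ[k] A) : LAct k (FreeMod k A) (FreeMod k A) :=
  extendProd
    (lhd.flip.compr₂ (Finsupp.lsingle 0 ∘ₗ del k (FreeMod k A) ∘ₗ inA k A)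
      + (rhd + lhd.flip).compr₂ (Finsupp.lsingle 1 ∘ₗ inA k A)
      + dia.compr₂ (Finsupp.lsingle 0 ∘ₗ inA k A))

/-- The `λ`-product on `k[∂] ⊗ A` with `a ≻_λ b = a ≻ b` for `a, b ∈ A`. -/
def succProd (su : A →ₗ[k] A →ₗ[k] A) : LAct k (FreeMod k A) (FreeMod k A) :=
  extendProd (su.compr₂ (Finsupp.lsingle 0 ∘ₗ inA k A))

theorem circProd_inA (lhd rhd dia : A →ₗ[k] A →ₗ[k] A) (c : k) (a b : A) :
    lm (circProd lhd rhd dia) c (inA k A a) (inA k A b)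
      = del k _ (inA k A (lhd b a)) + c • inA k A (rhd a b + lhd b a) + inA k A (dia a b) := by
  simp [lm, circProd, inA, extendProd_tmul, evalSc, evalAt_single]

theorem succProd_inA (su : A →ₗ[k] A →ₗ[k] A) (c : k) (a b : A) :
    lm (succProd su) c (inA k A a) (inA k A b) = inA k A (su a b) := by
  simp [lm, succProd, inA, extendProd_tmul, evalSc, evalAt_single]

theorem circProd_sesqui (lhd rhd dia : A →ₗ[k] A →ₗ[k] A) : Sesqui (circProd lhd rhd dia) :=
  extendProd_sesqui _

theorem succProd_sesqui (su : A →ₗ[k] A →ₗ[k] A) : Sesqui (succProd su) :=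
  extendProd_sesqui _

/-- The inclusion `A* → P^{*c}` for `P = k[∂] ⊗ A`: a functional `f` on `A` becomes the
conformal functional `p(∂)a ↦ f(a) p(λ)`. -/
def inDual {k A : Type*} [Field k] [AddCommGroup A] [Module k A] (f : Module.Dual k A) :
    ConfDual k (FreeMod k A) :=
  ConfDual.mk ((TensorProduct.rid k k[X]).toLinearMap ∘ₗ LinearMap.lTensor k[X] f) (by
    intro v
    induction v using TensorProduct.induction_on with
    | zero => simp
    | add v w hv hw => simp only [map_add, hv, hw, mul_add]
    | tmul p a =>
      change ((TensorProduct.rid k k[X]).toLinearMap ∘ₗ LinearMap.lTensor k[X] f)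
        ((Polynomial.X * p) ⊗ₜ a) = _
      simp)

theorem inDual_tmul (f : Module.Dual k A) (p : k[X]) (a : A) :
    (inDual f).toLin (p ⊗ₜ a) = f a • p := by
  simp [inDual, ConfDual.toLin_mk]

end Free

/-! ## Coalgebras and bialgebras -/

section Bialgebras

variable {k : Type*} [Field k]
variable {P : Type*} [AddCommGroup P] [Module k P] [Module k[X] P] [IsScalarTower k k[X] P]

/-- `∂ ⊗ I + I ⊗ ∂` on `P ⊗ P`. -/
def delTwo (k P : Type*) [Field k] [AddCommGroup P] [Module k P] [Module k[X] P]
    [IsScalarTower k k[X] P] : Module.End k (P ⊗[k] P) :=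
  LinearMap.rTensor P (del k P) + LinearMap.lTensor P (del k P)

/-- `∂ ⊗ I ⊗ I` on `P ⊗ P ⊗ P`. -/
def delA (k P : Type*) [Field k] [AddCommGroup P] [Module k P] [Module k[X] P]
    [IsScalarTower k k[X] P] : Module.End k (P ⊗[k] (P ⊗[k] P)) :=
  LinearMap.rTensor (P ⊗[k] P) (del k P)

/-- `I ⊗ ∂ ⊗ I` on `P ⊗ P ⊗ P`. -/
def delB (k P : Type*) [Field k] [AddCommGroup P] [Module k P] [Module k[X] P]
    [IsScalarTower k k[X] P] : Module.End k (P ⊗[k] (P ⊗[k] P)) :=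
  LinearMap.lTensor P (LinearMap.rTensor P (del k P))

/-- `I ⊗ I ⊗ ∂` on `P ⊗ P ⊗ P`. -/
def delC (k P : Type*) [Field k] [AddCommGroup P] [Module k P] [Module k[X] P]
    [IsScalarTower k k[X] P] : Module.End k (P ⊗[k] (P ⊗[k] P)) :=
  LinearMap.lTensor P (LinearMap.lTensor P (del k P))

/-- `∂ ⊗ I ⊗ I + I ⊗ ∂ ⊗ I + I ⊗ I ⊗ ∂` on `P ⊗ P ⊗ P`. -/
def delThree (k P : Type*) [Field k] [AddCommGroup P] [Module k P] [Module k[X] P]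
    [IsScalarTower k k[X] P] : Module.End k (P ⊗[k] (P ⊗[k] P)) :=
  delA k P + delB k P + delC k P

/-- `(I ⊗ g) f (a)`. -/
def coIter₂ (f g : P →ₗ[k] P ⊗[k] P) (a : P) : P ⊗[k] (P ⊗[k] P) := LinearMap.lTensor P g (f a)

/-- `(g ⊗ I) f (a)`. -/
def coIter₁ (f g : P →ₗ[k] P ⊗[k] P) (a : P) : P ⊗[k] (P ⊗[k] P) :=
  TensorProduct.assoc k P P P (LinearMap.rTensor P g (f a))

structure IsAssocConfCoalg (Δ : P →ₗ[k] P ⊗[k] P) : Prop where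
  hom : ∀ a, Δ (del k P a) = delTwo k P (Δ a)
  coassoc : ∀ a, coIter₂ Δ Δ a = coIter₁ Δ Δ a

def IsCocomm (Δ : P →ₗ[k] P ⊗[k] P) : Prop := ∀ a, Δ a = TensorProduct.comm k P P (Δ a)

structure IsLieConfCoalg (δ : P →ₗ[k] P ⊗[k] P) : Prop where
  hom : ∀ a, δ (del k P a) = delTwo k P (δ a)
  skew : ∀ a, δ a = -TensorProduct.comm k P P (δ a)
  coJacobi : ∀ a, coIter₂ δ δ a - TensorProduct.leftComm k P P P (coIter₂ δ δ a) = coIter₁ δ δ a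

structure IsPoissonConfCoalg (δ Δ : P →ₗ[k] P ⊗[k] P) : Prop where
  lie : IsLieConfCoalg δ
  assoc : IsAssocConfCoalg Δ
  cocomm : IsCocomm Δ
  compat : ∀ a,
    coIter₂ δ Δ a = coIter₁ Δ δ a + TensorProduct.leftComm k P P P (coIter₂ Δ δ a)

/-- `(f_c ⊗ I) t` for a scalar `c`, where `f : P → P[λ]`. -/
def actL (f : P →ₗ[k] LPoly P) (c : k) (t : P ⊗[k] P) : P ⊗[k] P := evalSc c (onLeft P f t)

/-- `(I ⊗ f_c) t` for a scalar `c`, where `f : P → P[λ]`. -/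
def actR (f : P →ₗ[k] LPoly P) (c : k) (t : P ⊗[k] P) : P ⊗[k] P := evalSc c (onRight P f t)

/-- `(f_μ ⊗ I) t` with `μ = -c - (∂ ⊗ I + I ⊗ ∂)`. -/
def actNegL (f : P →ₗ[k] LPoly P) (c : k) (t : P ⊗[k] P) : P ⊗[k] P :=
  evalAt (-(c • (1 : Module.End k (P ⊗[k] P))) - delTwo k P) (onLeft P f t)

/-- `(I ⊗ f_μ) t` with `μ = -c - (∂ ⊗ I + I ⊗ ∂)`. -/
def actNegR (f : P →ₗ[k] LPoly P) (c : k) (t : P ⊗[k] P) : P ⊗[k] P :=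
  evalAt (-(c • (1 : Module.End k (P ⊗[k] P))) - delTwo k P) (onRight P f t)

/-- Antisymmetric infinitesimal conformal bialgebras. The right multiplication
`R(a)_λ b = b_{-λ-∂} a` is `opp mu a`. -/
structure IsASIConfBialg (mu : LAct k P P) (Δ : P →ₗ[k] P ⊗[k] P) : Prop where
  assoc : IsAssocConf mu
  coassoc : IsAssocConfCoalg Δ
  compat₁ : ∀ (l : k) (a b : P),
    Δ (lm mu l a b) = actR (mu a) l (Δ b) + actNegL (opp mu b) l (Δ a)
  compat₂ : ∀ (l : k) (a b : P),
    (actNegL (mu b) l (Δ a) - actNegR (opp mu b) l (Δ a))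
      + TensorProduct.comm k P P (actL (mu a) l (Δ b) - actR (opp mu a) l (Δ b)) = 0

structure IsLieConfBialg (br : LAct k P P) (δ : P →ₗ[k] P ⊗[k] P) : Prop where
  lie : IsLieConf br
  coLie : IsLieConfCoalg δ
  cocycle : ∀ (l : k) (a b : P),
    δ (lm br l a b) = (actL (br a) l (δ b) + actR (br a) l (δ b))
      - (actNegL (br b) l (δ a) + actNegR (br b) l (δ a))

structure IsPoissonConfBialg (br mu : LAct k P P) (δ Δ : P →ₗ[k] P ⊗[k] P) : Prop where
  poisson : IsPoissonConf br mu
  coPoisson : IsPoissonConfCoalg δ Δ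
  lie : IsLieConfBialg br δ
  asi : IsASIConfBialg mu Δ
  compat₁ : ∀ (l : k) (a b : P),
    δ (lm mu l a b) = actL (mu a) l (δ b) + actNegL (mu b) l (δ a)
      + actR (br a) l (Δ b) + actNegR (br b) l (Δ a)
  compat₂ : ∀ (l : k) (a b : P),
    Δ (lm br l a b) = actL (br a) l (Δ b) + actR (br a) l (Δ b)
      - actNegR (mu b) l (δ a) + actNegL (mu b) l (δ a)

/-- `δ(a) = (ad(a)_λ ⊗ I + I ⊗ ad(a)_λ) r` at `λ = -(∂ ⊗ I + I ⊗ ∂)`. -/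
def coboundaryLie (br : LAct k P P) (r : P ⊗[k] P) : P →ₗ[k] P ⊗[k] P where
  toFun a := evalAt (-delTwo k P) (onLeft P (br a) r + onRight P (br a) r)
  map_add' a b := by
    simp only [onLeft, onRight, map_add, LinearMap.rTensor_add, LinearMap.lTensor_add,
      LinearMap.comp_add, LinearMap.add_apply]
    abel
  map_smul' c a := by
    simp only [onLeft, onRight, map_smul, LinearMap.rTensor_smul, LinearMap.lTensor_smul,
      LinearMap.comp_smul, LinearMap.smul_apply, map_add, smul_add, RingHom.id_apply]

/-- `Δ(a) = (I ⊗ L(a)_λ - L(a)_λ ⊗ I) r` at `λ = -(∂ ⊗ I + I ⊗ ∂)`. -/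
def coboundaryMul (mu : LAct k P P) (r : P ⊗[k] P) : P →ₗ[k] P ⊗[k] P where
  toFun a := evalAt (-delTwo k P) (onRight P (mu a) r - onLeft P (mu a) r)
  map_add' a b := by
    simp only [onLeft, onRight, map_add, map_sub, LinearMap.rTensor_add, LinearMap.lTensor_add,
      LinearMap.comp_add, LinearMap.add_apply]
    abel
  map_smul' c a := by
    simp only [onLeft, onRight, map_smul, LinearMap.rTensor_smul, LinearMap.lTensor_smul,
      LinearMap.comp_smul, LinearMap.smul_apply, map_sub, smul_sub, RingHom.id_apply]

/-- A Poisson conformal bialgebra whose two coproducts come from one tensor `r`. -/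
structure IsCoboundaryPoissonConfBialg (br mu : LAct k P P) (δ Δ : P →ₗ[k] P ⊗[k] P) :
    Prop where
  bialg : IsPoissonConfBialg br mu δ Δ
  coboundary : ∃ r : P ⊗[k] P, δ = coboundaryLie br r ∧ Δ = coboundaryMul mu r

/-! ### The Poisson conformal Yang-Baxter equation -/

/-- `(a ⊗ b) ⊗ (c ⊗ d) ↦ a_μ c ⊗ b ⊗ d` at `μ = I ⊗ ∂ ⊗ I`. -/
def ybFirst (β : LAct k P P) : (P ⊗[k] P) ⊗[k] (P ⊗[k] P) →ₗ[k] P ⊗[k] (P ⊗[k] P) :=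
  evalAt (delB k P) ∘ₗ onLeft (P ⊗[k] P) (TensorProduct.lift β)
    ∘ₗ (TensorProduct.tensorTensorTensorComm k P P P P).toLinearMap

/-- `(a ⊗ b) ⊗ (c ⊗ d) ↦ a ⊗ c_μ b ⊗ d` at `μ = T`. -/
def ybSecond (β : LAct k P P) (T : Module.End k (P ⊗[k] (P ⊗[k] P))) :
    (P ⊗[k] P) ⊗[k] (P ⊗[k] P) →ₗ[k] P ⊗[k] (P ⊗[k] P) :=
  evalAt T ∘ₗ onRight P (onLeft P (TensorProduct.lift β.flip))
    ∘ₗ LinearMap.lTensor P (TensorProduct.assoc k P P P).symm.toLinearMap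
    ∘ₗ (TensorProduct.assoc k P P (P ⊗[k] P)).toLinearMap

/-- `(a ⊗ b) ⊗ (c ⊗ d) ↦ a ⊗ c ⊗ b_μ d` at `μ = T`. -/
def ybThird (β : LAct k P P) (T : Module.End k (P ⊗[k] (P ⊗[k] P))) :
    (P ⊗[k] P) ⊗[k] (P ⊗[k] P) →ₗ[k] P ⊗[k] (P ⊗[k] P) :=
  evalAt T ∘ₗ onRight P (onRight P (TensorProduct.lift β))
    ∘ₗ (TensorProduct.assoc k P P (P ⊗[k] P)).toLinearMap
    ∘ₗ (TensorProduct.tensorTensorTensorComm k P P P P).toLinearMap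

/-- The tensor `[[r, r]]`. -/
def lieYB (br : LAct k P P) (r : P ⊗[k] P) : P ⊗[k] (P ⊗[k] P) :=
  ybFirst br (r ⊗ₜ r) - ybSecond br (delC k P) (r ⊗ₜ r) - ybThird br.flip (delB k P) (r ⊗ₜ r)

/-- The tensor `r • r`. -/
def mulYB (mu : LAct k P P) (r : P ⊗[k] P) : P ⊗[k] (P ⊗[k] P) :=
  ybThird mu (delA k P) (r ⊗ₜ r) - ybSecond mu (-(delA k P + delB k P)) (r ⊗ₜ r)
    + ybFirst mu (r ⊗ₜ r)

/-- `[[r, r]]` for `r = ∑ aᵢ ⊗ bᵢ`, written out: the sum over `i, j` of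
`[aᵢ_μ aⱼ] ⊗ bᵢ ⊗ bⱼ` at `μ = I ⊗ ∂ ⊗ I`, minus `aᵢ ⊗ [aⱼ_μ bᵢ] ⊗ bⱼ` at `μ = I ⊗ I ⊗ ∂`,
minus `aᵢ ⊗ aⱼ ⊗ [bⱼ_μ bᵢ]` at `μ = I ⊗ ∂ ⊗ I`. -/
theorem lieYB_sum {ι : Type*} (s : Finset ι) (br : LAct k P P) (a b : ι → P) :
    lieYB br (∑ i ∈ s, a i ⊗ₜ[k] b i) = ∑ i ∈ s, ∑ j ∈ s,
      ((br (a i) (a j)).sum (fun n v => (delB k P ^ n) (v ⊗ₜ[k] (b i ⊗ₜ[k] b j)))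
      - (br (a j) (b i)).sum (fun n v => (delC k P ^ n) (a i ⊗ₜ[k] (v ⊗ₜ[k] b j)))
      - (br (b j) (b i)).sum (fun n v => (delB k P ^ n) (a i ⊗ₜ[k] (a j ⊗ₜ[k] v)))) := by
  simp only [lieYB, TensorProduct.sum_tmul, TensorProduct.tmul_sum, map_sum,
    ← Finset.sum_sub_distrib]
  refine (Finset.sum_comm).trans ?_
  refine Finset.sum_congr rfl fun i _ => Finset.sum_congr rfl fun j _ => ?_
  simp [ybFirst, ybSecond, ybThird, onLeft_tmul, onRight_tmul, evalAt, onCoeff,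
    Finsupp.sum_mapRange_index, Finsupp.mapRange_mapRange]

/-- `r • r` for `r = ∑ aᵢ ⊗ bᵢ`, written out: the sum over `i, j` of
`aᵢ ⊗ aⱼ ⊗ bᵢ_μ bⱼ` at `μ = ∂ ⊗ I ⊗ I`, minus `aᵢ ⊗ aⱼ_μ bᵢ ⊗ bⱼ` at
`μ = -(∂ ⊗ I ⊗ I + I ⊗ ∂ ⊗ I)`, plus `aᵢ_μ aⱼ ⊗ bᵢ ⊗ bⱼ` at `μ = I ⊗ ∂ ⊗ I`. -/
theorem mulYB_sum {ι : Type*} (s : Finset ι) (mu : LAct k P P) (a b : ι → P) :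
    mulYB mu (∑ i ∈ s, a i ⊗ₜ[k] b i) = ∑ i ∈ s, ∑ j ∈ s,
      ((mu (b i) (b j)).sum (fun n v => (delA k P ^ n) (a i ⊗ₜ[k] (a j ⊗ₜ[k] v)))
      - (mu (a j) (b i)).sum
          (fun n v => ((-(delA k P + delB k P)) ^ n) (a i ⊗ₜ[k] (v ⊗ₜ[k] b j)))
      + (mu (a i) (a j)).sum (fun n v => (delB k P ^ n) (v ⊗ₜ[k] (b i ⊗ₜ[k] b j)))) := by
  simp only [mulYB, TensorProduct.sum_tmul, TensorProduct.tmul_sum, map_sum,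
    ← Finset.sum_sub_distrib, ← Finset.sum_add_distrib]
  refine (Finset.sum_comm).trans ?_
  refine Finset.sum_congr rfl fun i _ => Finset.sum_congr rfl fun j _ => ?_
  simp [ybFirst, ybSecond, ybThird, onLeft_tmul, onRight_tmul, evalAt, onCoeff,
    Finsupp.sum_mapRange_index, Finsupp.mapRange_mapRange]

/-- `r` solves the Poisson conformal Yang-Baxter equation: both tensors vanish modulo the image
of `∂ ⊗ I ⊗ I + I ⊗ ∂ ⊗ I + I ⊗ I ⊗ ∂`. -/
structure IsPCYBESolution (br mu : LAct k P P) (r : P ⊗[k] P) : Prop where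
  lie : lieYB br r ∈ LinearMap.range (delThree k P)
  mul : mulYB mu r ∈ LinearMap.range (delThree k P)

def IsSkewSymm (r : P ⊗[k] P) : Prop := TensorProduct.comm k P P r = -r

end Bialgebras

/-! ## The semi-direct product attached to a pre-PGD-algebra -/

section Hat

variable {k : Type*} [Field k] {A : Type*} [AddCommGroup A] [Module k A]

/-- The `k[∂]`-module `P ⊕ P^{*c}` for `P = k[∂] ⊗ A`. -/
abbrev HatMod (k A : Type*) [Field k] [AddCommGroup A] [Module k A] :=
  FreeMod k A × ConfDual k (FreeMod k A)

variable [FiniteDimensional k A]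

/-- The dual action `L_∘*` of `P = k[∂] ⊗ A` on `P^{*c}`. -/
def dualCirc (lhd rhd dia : A →ₗ[k] A →ₗ[k] A) :
    LAct k (FreeMod k A) (ConfDual k (FreeMod k A)) :=
  dualAct (circProd_sesqui lhd rhd dia)

/-- The dual action `L_≻*` of `P = k[∂] ⊗ A` on `P^{*c}`. -/
def dualSucc (su : A →ₗ[k] A →ₗ[k] A) : LAct k (FreeMod k A) (ConfDual k (FreeMod k A)) :=
  dualAct (succProd_sesqui su)

/-- The bracket of `P ⋉ P^{*c}` with respect to `(L_∘*, -L_≻*)`. -/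
def hatBr (lhd rhd dia : A →ₗ[k] A →ₗ[k] A) : LAct k (HatMod k A) (HatMod k A) :=
  semiBr (commutatorBr (circProd lhd rhd dia)) (dualCirc lhd rhd dia)

/-- The commutative product of `P ⋉ P^{*c}` with respect to `(L_∘*, -L_≻*)`. -/
def hatMul (su : A →ₗ[k] A →ₗ[k] A) : LAct k (HatMod k A) (HatMod k A) :=
  semiMul (symmMul (succProd su)) (-dualSucc su)

end Hat

/-- `r = ∑ (eᵢ ⊗ eᵢ* - eᵢ* ⊗ eᵢ)` in `(P ⊕ P^{*c}) ⊗ (P ⊕ P^{*c})`. -/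
def basisTensor {k A : Type*} [Field k] [AddCommGroup A] [Module k A] {n : ℕ}
    (e : Module.Basis (Fin n) k A) : HatMod k A ⊗[k] HatMod k A :=
  ∑ i, (((inA k A (e i), 0) : HatMod k A) ⊗ₜ[k] ((0, inDual (e.coord i)) : HatMod k A)
    - ((0, inDual (e.coord i)) : HatMod k A) ⊗ₜ[k] ((inA k A (e i), 0) : HatMod k A))

end
end PConf

open PConf

open scoped TensorProduct Polynomial

namespace PConf

noncomputable section

set_option maxSynthPendingDepth 3

/-! Conformal identities are checked fibre by fibre. In the fibre at `α` the operator `∂` acts as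
the scalar `α`. If `a` lies over `α` and `v` over `β`, sesquilinearity forces `λ = -α` and puts `a_λ
v` over `α + β`. A `λ`-product is thus seen as a family of bilinear maps between fibres, additive in
the degree (`Induces`), while `-λ-∂` merely exchanges the roles of the two degrees. Since `k` is
infinite, the fibres of `k[∂] ⊗ A` and of its conformal dual separate points (`IsFibration`), so a
conformal axiom holds once its version graded by the scalars does.

For `P = k[∂] ⊗ A` every fibre is `A`, and `∘_λ` becomes `β (b ◁ a) - α (a ▷ b) + a ◇ b`. Comparing
coefficients of monomials in the degrees, the pre-PGD axioms make this and `≻` a graded pre-Poisson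
algebra (`IsPrePGD.isPrePoissonFam`). The classical constructions then apply degree by degree:
commutator and anticommutator give a Poisson algebra, transposed left multiplications give a
representation on the graded dual, and the semi-direct product on `A ⊕ A*` is Poisson. A functional
of degree `β` pairs with vectors of degree `-β`, which reflects that `∂` acts on the conformal dual
by `-λ`.

The rest is governed by the symplectic form `ω` on `A ⊕ A*`. Its cyclic sums `ω(p, qs) + ω(q, sp) +
ω(s, pq)` vanish for the bracket and for the product (`isCocycleFor_semiBrFam`,
`isCocycleFor_semiMulFam`), and `r` has in every fibre the constant value `R`, the inverse of `ω`.
This one fact is used twice.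

First, membership in the image of `∂^{⊗3}` can be tested on fibres of total degree zero
(`mem_range_delThree`). There, contracting a Yang-Baxter tensor with three functionals `ω u`, `ω v`,
`ω w` turns each copy of `R` into a vector, and the result is a cyclic sum of the above kind, hence
zero.

Second, the same cocycle identity shows that the coboundary maps `δ` and `Δ` are the transposes,
with respect to `ω`, of the bracket and the product (`Induces.isDualTo_coboundaryLie`,
`Induces.isDualTo_coboundaryMul`). The coalgebra axioms are therefore the Poisson axioms transposed.
The compatibility conditions follow from the Poisson identities applied in each leg of `R`, together
with `τR = -R`. -/

/-! ## Separating families of linear maps -/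

section Separating

variable {k : Type*} [Field k] {U V W E F : Type*} [AddCommGroup U] [Module k U]
  [AddCommGroup V] [Module k V] [AddCommGroup W] [Module k W]
  [AddCommGroup E] [Module k E] [AddCommGroup F] [Module k F] {ι κ : Type*}

/-- A family of linear maps that jointly separates points. -/
def Separating (φ : ι → V →ₗ[k] E) : Prop := ∀ v, (∀ i, φ i v = 0) → v = 0

theorem Separating.ext {φ : ι → V →ₗ[k] E} (h : Separating φ) {v w : V}
    (hvw : ∀ i, φ i v = φ i w) : v = w :=
  sub_eq_zero.mp (h _ fun i => by rw [map_sub, hvw, sub_self])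

/-- A basis of `W` identifies `V ⊗ W` with finitely supported families in `V`, and `φ i ⊗ I` acts on
such a family coordinatewise. -/
theorem Separating.rTensor {φ : ι → V →ₗ[k] E} (h : Separating φ) :
    Separating fun i => LinearMap.rTensor W (φ i) := by
  classical
  intro t ht
  let b := Module.Basis.ofVectorSpace k W
  apply (TensorProduct.equivFinsuppOfBasisRight (M := V) b).injective
  rw [map_zero]
  ext j
  refine h _ fun i => ?_
  have key : ∀ t : V ⊗[k] W, φ i (TensorProduct.equivFinsuppOfBasisRight b t j)
      = TensorProduct.equivFinsuppOfBasisRight b (LinearMap.rTensor W (φ i) t) j := by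
    intro t
    induction t using TensorProduct.induction_on with
    | zero => simp
    | add x y hx hy => simp only [map_add, Finsupp.add_apply, hx, hy]
    | tmul v w => simp
  rw [key, ht]
  simp

theorem Separating.lTensor {φ : ι → V →ₗ[k] E} (h : Separating φ) :
    Separating fun i => LinearMap.lTensor W (φ i) := by
  intro t ht
  apply (TensorProduct.comm k W V).injective
  rw [map_zero]
  refine h.rTensor _ fun i => ?_
  have := congrArg (TensorProduct.comm k W E) (ht i)
  rw [map_zero] at this
  rw [← this]
  exact TensorProduct.map_comm (φ i) LinearMap.id t

theorem Separating.map {φ : ι → V →ₗ[k] E} {ψ : κ → W →ₗ[k] F} (h : Separating φ)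
    (h' : Separating ψ) :
    Separating fun p : ι × κ => TensorProduct.map (φ p.1) (ψ p.2) := by
  intro t ht
  refine h'.lTensor t fun j => h.rTensor _ fun i => ?_
  rw [← ht (i, j), ← LinearMap.comp_apply, LinearMap.rTensor_comp_lTensor]

theorem Separating.comp {φ : ι → V →ₗ[k] E} {ψ : κ → E →ₗ[k] F} (h : Separating φ)
    (h' : Separating ψ) : Separating fun p : ι × κ => ψ p.2 ∘ₗ φ p.1 :=
  fun v hv => h v fun i => h' _ fun j => hv (i, j)

end Separating

/-! ## Values of polynomials with vector coefficients -/

section Values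

variable {k : Type*} [Field k] {U V W E : Type*} [AddCommGroup U] [Module k U]
  [AddCommGroup V] [Module k V] [AddCommGroup W] [Module k W] [AddCommGroup E] [Module k E]

/-- Under a linear map that turns the operator `T` into the scalar `c`, substituting `T` becomes
substituting `c`. -/
theorem map_evalAt_of_eigen (φ : V →ₗ[k] E) (T : Module.End k V) (c : k)
    (h : ∀ v, φ (T v) = c • φ v) (w : LPoly V) : φ (evalAt T w) = φ (evalSc c w) := by
  have hpow : ∀ n v, φ ((T ^ n) v) = c ^ n • φ v := by
    intro n
    induction n with
    | zero => simp
    | succ n ih => intro v; rw [pow_succ, Module.End.mul_apply, ih, h, smul_smul, pow_succ]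
  induction w using Finsupp.induction_linear with
  | zero => simp
  | add f g hf hg => simp only [map_add, hf, hg]
  | single n v => simp [evalSc, evalAt_single, hpow, smul_pow]

theorem evalSc_onCoeff (f : V →ₗ[k] W) (c : k) (w : LPoly V) :
    evalSc c (onCoeff f w) = f (evalSc c w) := by
  induction w using Finsupp.induction_linear with
  | zero => simp
  | add f g hf hg => simp only [map_add, hf, hg]
  | single n v => simp [onCoeff, evalSc, evalAt_single, smul_pow]

theorem evalSc_onLeft (f : U →ₗ[k] LPoly V) (c : k) (t : U ⊗[k] W) :
    evalSc c (onLeft W f t) = LinearMap.rTensor W (evalSc c ∘ₗ f) t := by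
  induction t using TensorProduct.induction_on with
  | zero => simp
  | add x y hx hy => simp only [map_add, hx, hy]
  | tmul u w => rw [onLeft_tmul, evalSc_onCoeff]; rfl

theorem evalSc_onRight (f : U →ₗ[k] LPoly V) (c : k) (t : W ⊗[k] U) :
    evalSc c (onRight W f t) = LinearMap.lTensor W (evalSc c ∘ₗ f) t := by
  induction t using TensorProduct.induction_on with
  | zero => simp
  | add x y hx hy => simp only [map_add, hx, hy]
  | tmul u w => rw [onRight_tmul, evalSc_onCoeff]; rfl

variable [Module k[X] V] [IsScalarTower k k[X] V]

/-- In the fibre at `γ` the operator `∂` is the scalar `γ`, so `-λ-∂` at `λ = c` is the scalar `-c -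
γ`. -/
theorem map_evalSc_flipLam {ev : V →ₗ[k] E} {γ : k} (h : ∀ v, ev (del k V v) = γ • ev v) (c : k)
    (w : LPoly V) : ev (evalSc c (flipLam k V w)) = ev (evalSc (-c - γ) w) := by
  rw [evalSc_flipLam]
  refine map_evalAt_of_eigen _ _ _ (fun v => ?_) _
  simp [h, sub_smul]

end Values

/-! ## Fibres

The fibre of a free `k[∂]`-module at a scalar is its quotient on which `∂` acts as that scalar. -/

section Fibres

variable {k : Type*} [Field k] {P V E F : Type*}
  [AddCommGroup P] [Module k P] [AddCommGroup V] [Module k V]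
  [AddCommGroup E] [Module k E] [AddCommGroup F] [Module k F]

/-- Families of bilinear maps, thought of as maps from degrees `α` and `β` to degree `α + β`. -/
abbrev BilinFam (k E F : Type*) [Field k] [AddCommGroup E] [Module k E] [AddCommGroup F]
    [Module k F] := k → k → E →ₗ[k] F →ₗ[k] F

/-- The opposite of a family of products. -/
def BilinFam.opp (M : BilinFam k E E) : BilinFam k E E := fun α β => (M β α).flip

/-- The `λ`-action `ρ` induces the family `M` on fibres. -/
def Induces (evP : k → P →ₗ[k] E) (evV : k → V →ₗ[k] F) (ρ : LAct k P V) (M : BilinFam k E F) :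
    Prop :=
  ∀ α β a v, evV (α + β) (lm ρ (-α) a v) = M α β (evP α a) (evV β v)

variable {evP : k → P →ₗ[k] E} {evV : k → V →ₗ[k] F} {ρ σ : LAct k P V} {M N : BilinFam k E F}

theorem Induces.apply (h : Induces evP evV ρ M) (α β : k) (a : P) (v : V) :
    evV (α + β) (lm ρ (-α) a v) = M α β (evP α a) (evV β v) := h α β a v

theorem Induces.lm (h : Induces evP evV ρ M) {α β γ c : k} (hc : c = -α) (hγ : γ = α + β)
    (a : P) (v : V) : evV γ (lm ρ c a v) = M α β (evP α a) (evV β v) := by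
  subst hc hγ; exact h α β a v

theorem Induces.add (h : Induces evP evV ρ M) (h' : Induces evP evV σ N) :
    Induces evP evV (ρ + σ) (M + N) := by
  intro α β a v
  have h1 := h α β a v
  have h2 := h' α β a v
  simp only [PConf.lm] at h1 h2
  simp [PConf.lm, h1, h2]

theorem Induces.neg (h : Induces evP evV ρ M) : Induces evP evV (-ρ) (-M) := by
  intro α β a v
  have h1 := h α β a v
  simp only [PConf.lm] at h1
  simp [PConf.lm, h1]

theorem Induces.sub (h : Induces evP evV ρ M) (h' : Induces evP evV σ N) :
    Induces evP evV (ρ - σ) (M - N) := by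
  rw [sub_eq_add_neg ρ, sub_eq_add_neg M]
  exact h.add h'.neg

variable [Module k[X] V] [IsScalarTower k k[X] V]

/-- A separating family of linear maps `ev α` under which `∂` acts as the scalar `α`. -/
structure IsFibration (ev : k → V →ₗ[k] E) : Prop where
  del : ∀ α v, ev α (del k V v) = α • ev α v
  sep : Separating ev

/-- Over `γ = α + β`, the substitution `-c-∂` with `c = -β` is the scalar `β - (α + β) = -α`, the
value of `λ` required by an argument `a` of degree `α`. Here the parameter records the degree of `v`
instead of that of `a`. -/
theorem Induces.lmNeg (h : Induces evP evV ρ M) (hV : IsFibration evV) {α β γ c : k}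
    (hc : c = -β) (hγ : γ = α + β) (a : P) (v : V) :
    evV γ (lmNeg ρ c a v) = M α β (evP α a) (evV β v) := by
  rw [PConf.lmNeg, map_evalSc_flipLam (hV.del γ)]
  exact h.lm (by rw [hc, hγ]; ring) hγ a v

/-- A value at `λ = c` in the fibre at `γ` is the case `α = -c`, `β = γ + c`, so all values in all
fibres are covered. -/
theorem IsFibration.ext_lpoly [Infinite k] (hV : IsFibration evV) {w w' : LPoly V}
    (h : ∀ α β, evV (α + β) (evalSc (-α) w) = evV (α + β) (evalSc (-α) w')) : w = w' := by
  refine LPoly.ext_of_evalSc (k := k) fun c => hV.sep.ext fun γ => ?_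
  have := h (-c) (γ + c)
  rwa [neg_neg, show -c + (γ + c) = γ by ring] at this

theorem Induces.ext [Infinite k] (hV : IsFibration evV) (h : Induces evP evV ρ M)
    (h' : Induces evP evV σ M) (a : P) (v : V) : ρ a v = σ a v :=
  hV.ext_lpoly fun α β => (h α β a v).trans (h' α β a v).symm

variable [Module k[X] P] [IsScalarTower k k[X] P]

theorem Induces.opp {β : LAct k P P} {M : BilinFam k E E} (h : Induces evP evP β M)
    (hP : IsFibration evP) : Induces evP evP (opp β) M.opp := by
  intro x y a b
  exact h.lmNeg hP rfl (add_comm x y) b a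

/-- Both laws amount to `∂` being the scalars `α`, `β` and `α + β` on the three fibres, with `λ =
-α`. -/
theorem Induces.sesqui [Infinite k] (h : Induces evP evV ρ M) (hP : IsFibration evP)
    (hV : IsFibration evV) : Sesqui ρ where
  left a v := hV.ext_lpoly fun α β => by
    have h1 := h α β (PConf.del k P a) v
    rw [hP.del, map_smul, LinearMap.smul_apply, ← h α β a v] at h1
    refine h1.trans ?_
    rw [map_neg, evalSc_mulLam, neg_smul, neg_neg, map_smul]
    rfl
  right a v := hV.ext_lpoly fun α β => by
    have h1 := h α β a (PConf.del k V v)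
    rw [hV.del, map_smul, ← h α β a v] at h1
    refine h1.trans ?_
    rw [map_add, evalSc_mulLam, evalSc_delPoly, map_add, hV.del, map_smul, ← add_smul,
      show α + β + -α = β by ring]
    rfl

end Fibres

/-! ## Poisson and pre-Poisson algebras graded by the scalars -/

section Families

variable {k : Type*} [Field k] {E F : Type*}
  [AddCommGroup E] [Module k E] [AddCommGroup F] [Module k F]

/-- Families of products that make `⨁ α, E` a Poisson algebra graded by the scalars. -/
structure IsPoissonFam (B M : BilinFam k E E) : Prop where
  skew : ∀ α β a b, B α β a b = -B β α b a
  jacobi : ∀ α β γ a b c,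
    B α (β + γ) a (B β γ b c) = B (α + β) γ (B α β a b) c + B β (α + γ) b (B α γ a c)
  comm : ∀ α β a b, M α β a b = M β α b a
  assoc : ∀ α β γ a b c, M (α + β) γ (M α β a b) c = M α (β + γ) a (M β γ b c)
  leibniz : ∀ α β γ a b c,
    B α (β + γ) a (M β γ b c) = M (α + β) γ (B α β a b) c + M β (α + γ) b (B α γ a c)

/-- Families of products that make `⨁ α, E` a pre-Poisson algebra graded by the scalars. -/
structure IsPrePoissonFam (C S : BilinFam k E E) : Prop where
  leftSymm : ∀ α β γ a b c,
    C α (β + γ) a (C β γ b c) - C (α + β) γ (C α β a b) c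
      = C β (α + γ) b (C α γ a c) - C (α + β) γ (C β α b a) c
  zinbiel : ∀ α β γ a b c,
    S α (β + γ) a (S β γ b c) = S (α + β) γ (S α β a b + S β α b a) c
  compat₁ : ∀ α β γ a b c,
    S (α + β) γ (C α β a b - C β α b a) c
      = C α (β + γ) a (S β γ b c) - S β (α + γ) b (C α γ a c)
  compat₂ : ∀ α β γ a b c,
    C (α + β) γ (S α β a b + S β α b a) c
      = S α (β + γ) a (C β γ b c) + S β (α + γ) b (C α γ a c)

/-- Representations of a graded Poisson algebra on `⨁ α, F`. -/
structure IsPoissonRepFam (B M : BilinFam k E E) (ρ τ : BilinFam k E F) : Prop where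
  rep : ∀ α β γ a b v,
    ρ (α + β) γ (B α β a b) v = ρ α (β + γ) a (ρ β γ b v) - ρ β (α + γ) b (ρ α γ a v)
  mulRep : ∀ α β γ a b v, τ (α + β) γ (M α β a b) v = τ α (β + γ) a (τ β γ b v)
  compat₁ : ∀ α β γ a b v,
    ρ (α + β) γ (M α β a b) v = τ β (α + γ) b (ρ α γ a v) + τ α (β + γ) a (ρ β γ b v)
  compat₂ : ∀ α β γ a b v,
    ρ α (β + γ) a (τ β γ b v) = τ (α + β) γ (B α β a b) v + τ β (α + γ) b (ρ α γ a v)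

theorem BilinFam.opp_apply (M : BilinFam k E E) (α β : k) (a b : E) :
    M.opp α β a b = M β α b a := rfl

/-- The classical passage from pre-Poisson to Poisson algebras, with degrees carried along. The
Jacobi identity is the sum of the three cyclic instances of left symmetry; the other two identities
are similar combinations of permuted axioms. -/
theorem IsPrePoissonFam.isPoissonFam {C S : BilinFam k E E} (h : IsPrePoissonFam C S) :
    IsPoissonFam (C - C.opp) (S + S.opp) where
  skew α β a b := by simp [BilinFam.opp_apply]
  comm α β a b := by simp [BilinFam.opp_apply, add_comm]
  jacobi α β γ a b c := by
    have h1 := h.leftSymm α β γ a b c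
    have h2 := h.leftSymm β γ α b c a
    have h3 := h.leftSymm γ α β c a b
    simp only [Pi.sub_apply, LinearMap.sub_apply, map_sub, BilinFam.opp_apply]
    -- Degrees occur as indices of the families, so their sums need a common normal form before
    -- `module` can recognise equal terms.
    simp only [add_comm γ, add_comm β α] at h1 h2 h3 ⊢
    linear_combination (norm := module) h1 + h2 + h3
  assoc α β γ a b c := by
    have h1 := h.zinbiel α β γ a b c
    have h2 := h.zinbiel γ β α c b a
    have h3 := h.zinbiel α γ β a c b
    have h4 := h.zinbiel γ α β c a b
    simp only [Pi.add_apply, LinearMap.add_apply, map_add, BilinFam.opp_apply] at h1 h2 h3 h4 ⊢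
    simp only [add_comm γ, add_comm β α] at h1 h2 h3 h4 ⊢
    linear_combination (norm := module) h2 + h4 - h1 - h3
  leibniz α β γ a b c := by
    have h1 := h.compat₁ α β γ a b c
    have h2 := h.compat₁ α γ β a c b
    have h3 := h.compat₂ β γ α b c a
    simp only [Pi.add_apply, LinearMap.add_apply, map_add, BilinFam.opp_apply,
      Pi.sub_apply, LinearMap.sub_apply, map_sub] at h1 h2 h3 ⊢
    simp only [add_comm γ, add_comm β α] at h1 h2 h3 ⊢
    linear_combination (norm := module) - h1 - h2 - h3

/-- The dual of a family of actions, on the graded dual. -/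
def BilinFam.dual (M : BilinFam k E F) : BilinFam k E (F →ₗ[k] k) :=
  fun α β => -((LinearMap.llcomp k F F k).flip ∘ₗ M α (-(α + β)))

/-- The degrees are those of a graded transpose: a functional of degree `α + β` is tested on `v` of
degree `-(α + β)`, and `a` moves `v` to degree `-β`, where `f` of degree `β` can be applied. -/
theorem BilinFam.dual_apply (M : BilinFam k E F) (α β : k) (a : E) (f : (F →ₗ[k] k)) (v : F) :
    M.dual α β a f v = -f (M α (-(α + β)) a v) := by
  simp only [BilinFam.dual, LinearMap.neg_apply]; rfl

/-- Each representation axiom is a combination of pre-Poisson axioms in degrees `α`, `β`, `-(α + β +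
γ)`, composed with `f`. Transposition reverses the order of operators. This is harmless for the
commutative product, and the sign in `-S.dual` makes that action multiplicative. -/
theorem IsPrePoissonFam.isPoissonRepFam_dual {C S : BilinFam k E E} (h : IsPrePoissonFam C S) :
    IsPoissonRepFam (C - C.opp) (S + S.opp) C.dual (-S.dual) where
  rep α β γ a b f := by
    ext v
    have h1 := congrArg f (h.leftSymm α β (-(α + β + γ)) a b v)
    simp only [show β + -(α + β + γ) = -(α + γ) by ring,
      show α + -(α + β + γ) = -(β + γ) by ring] at h1
    simp only [LinearMap.sub_apply, BilinFam.dual_apply, Pi.sub_apply, map_sub,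
      BilinFam.opp_apply, show α + (β + γ) = α + β + γ by ring,
      show β + (α + γ) = α + β + γ by ring] at h1 ⊢
    linear_combination h1
  mulRep α β γ a b f := by
    ext v
    have h1 := congrArg f (h.zinbiel β α (-(α + β + γ)) b a v)
    simp only [show α + -(α + β + γ) = -(β + γ) by ring] at h1
    simp only [LinearMap.neg_apply, LinearMap.add_apply, BilinFam.dual_apply, Pi.add_apply,
      map_add, Pi.neg_apply, map_neg, add_comm β α,
      BilinFam.opp_apply, show α + (β + γ) = α + β + γ by ring] at h1 ⊢
    linear_combination -h1
  compat₁ α β γ a b f := by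
    ext v
    have h1 := congrArg f (h.compat₂ α β (-(α + β + γ)) a b v)
    have h2 := congrArg f (h.compat₁ α β (-(α + β + γ)) a b v)
    have h3 := congrArg f (h.compat₁ β α (-(α + β + γ)) b a v)
    simp only [show β + -(α + β + γ) = -(α + γ) by ring, add_comm β α,
      show α + -(α + β + γ) = -(β + γ) by ring] at h1 h2 h3
    simp only [LinearMap.neg_apply, LinearMap.add_apply, BilinFam.dual_apply, Pi.add_apply,
      map_add, map_sub, LinearMap.sub_apply, Pi.neg_apply, BilinFam.opp_apply,
      show α + (β + γ) = α + β + γ by ring, show β + (α + γ) = α + β + γ by ring] at h1 h2 h3 ⊢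
    linear_combination -h1 - h2 - h3
  compat₂ α β γ a b f := by
    ext v
    have h2 := congrArg f (h.compat₁ α β (-(α + β + γ)) a b v)
    simp only [show β + -(α + β + γ) = -(α + γ) by ring,
      show α + -(α + β + γ) = -(β + γ) by ring] at h2
    simp only [LinearMap.neg_apply, LinearMap.add_apply, BilinFam.dual_apply, Pi.sub_apply,
      map_sub, LinearMap.sub_apply, Pi.neg_apply, map_neg, BilinFam.opp_apply,
      show α + (β + γ) = α + β + γ by ring, show β + (α + γ) = α + β + γ by ring] at h2 ⊢
    linear_combination -h2

/-! ### Graded semi-direct products. -/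

/-- The family of brackets of a semi-direct product. -/
def semiBrFam (B : BilinFam k E E) (ρ : BilinFam k E F) : BilinFam k (E × F) (E × F) :=
  fun α β => ((B α β).compl₁₂ (LinearMap.fst k E F) (LinearMap.fst k E F)).compr₂
      (LinearMap.inl k E F)
    + ((ρ α β).compl₁₂ (LinearMap.fst k E F) (LinearMap.snd k E F)
      - ((ρ β α).compl₁₂ (LinearMap.fst k E F) (LinearMap.snd k E F)).flip).compr₂
      (LinearMap.inr k E F)

theorem semiBrFam_apply (B : BilinFam k E E) (ρ : BilinFam k E F) (α β : k) (p q : E × F) :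
    semiBrFam B ρ α β p q = (B α β p.1 q.1, ρ α β p.1 q.2 - ρ β α q.1 p.2) := by
  simp [semiBrFam]

/-- The family of commutative products of a semi-direct product. -/
def semiMulFam (M : BilinFam k E E) (τ : BilinFam k E F) : BilinFam k (E × F) (E × F) :=
  fun α β => ((M α β).compl₁₂ (LinearMap.fst k E F) (LinearMap.fst k E F)).compr₂
      (LinearMap.inl k E F)
    + ((τ α β).compl₁₂ (LinearMap.fst k E F) (LinearMap.snd k E F)
      + ((τ β α).compl₁₂ (LinearMap.fst k E F) (LinearMap.snd k E F)).flip).compr₂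
      (LinearMap.inr k E F)

theorem semiMulFam_apply (M : BilinFam k E E) (τ : BilinFam k E F) (α β : k) (p q : E × F) :
    semiMulFam M τ α β p q = (M α β p.1 q.1, τ α β p.1 q.2 + τ β α q.1 p.2) := by
  simp [semiMulFam]

/-- The first component is the axiom in `E`. The second is linear in the `F`-components, and the
part with the `F`-component in any one of the three arguments is a module axiom with permuted
degrees. -/
theorem IsPoissonFam.semi {B M : BilinFam k E E} {ρ τ : BilinFam k E F} (h : IsPoissonFam B M)
    (h' : IsPoissonRepFam B M ρ τ) : IsPoissonFam (semiBrFam B ρ) (semiMulFam M τ) where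
  skew α β p q := by
    ext
    · simp [semiBrFam_apply, ← h.skew]
    · simp [semiBrFam_apply]
  comm α β p q := by
    ext
    · simp [semiMulFam_apply, ← h.comm α β]
    · simp [semiMulFam_apply, add_comm]
  jacobi α β γ p q s := by
    ext
    · simpa [semiBrFam_apply] using h.jacobi α β γ p.1 q.1 s.1
    · have h1 := h'.rep α β γ p.1 q.1 s.2
      have h2 := h'.rep β γ α q.1 s.1 p.2
      have h3 := h'.rep α γ β p.1 s.1 q.2
      simp only [semiBrFam_apply, Prod.snd_add, map_sub]
      simp only [add_comm γ, add_comm β α] at h1 h2 h3 ⊢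
      linear_combination (norm := module) -h1 - h2 + h3
  assoc α β γ p q s := by
    ext
    · simpa [semiMulFam_apply] using h.assoc α β γ p.1 q.1 s.1
    · have h1 := h'.mulRep α β γ p.1 q.1 s.2
      have h2 := h'.mulRep γ β α s.1 q.1 p.2
      have h3 := h'.mulRep α γ β p.1 s.1 q.2
      have h4 := h'.mulRep γ α β s.1 p.1 q.2
      have h5 := h.comm γ β s.1 q.1
      have h6 := h.comm γ α s.1 p.1
      rw [h5] at h2
      rw [h6] at h4
      simp only [semiMulFam_apply, map_add]
      simp only [add_comm γ, add_comm β α] at h1 h2 h3 h4 ⊢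
      linear_combination (norm := module) h1 - h2 + h3 - h4
  leibniz α β γ p q s := by
    ext
    · simpa [semiMulFam_apply, semiBrFam_apply] using h.leibniz α β γ p.1 q.1 s.1
    · have h1 := h'.compat₁ β γ α q.1 s.1 p.2
      have h2 := h'.compat₂ α β γ p.1 q.1 s.2
      have h3 := h'.compat₂ α γ β p.1 s.1 q.2
      simp only [semiMulFam_apply, semiBrFam_apply, Prod.snd_add, map_add, map_sub]
      simp only [add_comm γ, add_comm β α] at h1 h2 h3 ⊢
      linear_combination (norm := module) -h1 + h2 + h3

/-! ### The symplectic form and its cocycle identities. -/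

/-- The symplectic form on `F ⊕ F*`. -/
def pairForm (k F : Type*) [Field k] [AddCommGroup F] [Module k F] :
    (F × (F →ₗ[k] k)) →ₗ[k] (F × (F →ₗ[k] k)) →ₗ[k] k :=
  (LinearMap.id (R := k) (M := F →ₗ[k] k)).compl₁₂ (LinearMap.snd k _ _)
      (LinearMap.fst k _ _)
    - ((LinearMap.id (R := k) (M := F →ₗ[k] k)).compl₁₂ (LinearMap.snd k _ _)
      (LinearMap.fst k _ _)).flip

theorem pairForm_apply (p q : F × (F →ₗ[k] k)) :
    pairForm k F p q = p.2 q.1 - q.2 p.1 := by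
  simp [pairForm]

theorem pairForm_separating : Separating (pairForm k F) := by
  intro v hv
  ext1
  · rw [Prod.fst_zero, ← Module.forall_dual_apply_eq_zero_iff k]
    intro f
    simpa [pairForm_apply] using hv (0, f)
  · ext a
    simpa [pairForm_apply] using hv (a, 0)

/-- `ω(p, q s) + ω(q, s p) + ω(s, p q) = 0` for elements whose degrees add up to zero. -/
def IsCocycleFor (ω : E →ₗ[k] E →ₗ[k] k) (M : BilinFam k E E) : Prop :=
  ∀ α β γ p q s, α + β + γ = 0 → ω p (M β γ q s) + ω q (M γ α s p) + ω s (M α β p q) = 0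

/-- For each of the three functionals, say `f` from `p`, the terms `f(C(q, s))` and `f(C(s, q))`
each occur twice with opposite signs: once from the bracket in `E` and once from the dual action.
Total degree zero makes their degrees agree. -/
theorem isCocycleFor_semiBrFam (C : BilinFam k E E) :
    IsCocycleFor (pairForm k E) (semiBrFam (C - C.opp) C.dual) := by
  intro α β γ p q s h
  obtain rfl : γ = -(α + β) := by linear_combination h
  simp only [pairForm_apply, semiBrFam_apply, LinearMap.sub_apply, BilinFam.dual_apply,
    Pi.sub_apply, map_sub, BilinFam.opp_apply]
  simp only [show -(β + -(α + β)) = α by ring, show -(-(α + β) + β) = α by ring,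
    show -(-(α + β) + α) = β by ring, show -(α + -(α + β)) = β by ring, add_comm β α]
  ring

/-- The same cancellation: the action is `-S.dual`, so the two dual-action terms remove the two
terms of the symmetrised product. -/
theorem isCocycleFor_semiMulFam (S : BilinFam k E E) :
    IsCocycleFor (pairForm k E) (semiMulFam (S + S.opp) (-S.dual)) := by
  intro α β γ p q s h
  obtain rfl : γ = -(α + β) := by linear_combination h
  simp only [pairForm_apply, semiMulFam_apply, LinearMap.add_apply, LinearMap.neg_apply,
    BilinFam.dual_apply, Pi.add_apply, Pi.neg_apply, map_add, BilinFam.opp_apply]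
  simp only [show -(β + -(α + β)) = α by ring, show -(-(α + β) + β) = α by ring,
    show -(-(α + β) + α) = β by ring, show -(α + -(α + β)) = β by ring, add_comm β α]
  ring

end Families

/-! ## Conformal algebras from graded algebras -/

section Conformal

variable {k : Type*} [Field k] {P V E F : Type*}
  [AddCommGroup P] [Module k P] [Module k[X] P] [IsScalarTower k k[X] P]
  [AddCommGroup V] [Module k V] [Module k[X] V] [IsScalarTower k k[X] V]
  [AddCommGroup E] [Module k E] [AddCommGroup F] [Module k F]
  {evP : k → P →ₗ[k] E} {evV : k → V →ₗ[k] F}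

/-- Two scalar parameters and a degree, in terms of the degrees of three arguments. -/
theorem IsFibration.ext_of_degrees {ev : k → V →ₗ[k] F} (hV : IsFibration ev) {f g : k → k → V}
    (h : ∀ α β γ, ev (α + (β + γ)) (f (-α) (-β)) = ev (α + (β + γ)) (g (-α) (-β))) (l m : k) :
    f l m = g l m := by
  refine hV.sep.ext fun γ => ?_
  have := h (-l) (-m) (γ + l + m)
  rwa [neg_neg, neg_neg, show -l + (-m + (γ + l + m)) = γ by ring] at this

variable [Infinite k]

/-- At `λ = -α`, `μ = -β` and in the fibre at `α + β + γ`, every three-variable axiom is the graded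
one applied to the fibres of `a`, `b`, `c`. The symmetry axioms hold because both sides induce the
same family. -/
theorem IsPoissonFam.isPoissonConf {br mu : LAct k P P} {B M : BilinFam k E E}
    (h : IsPoissonFam B M) (hP : IsFibration evP) (hB : Induces evP evP br B)
    (hM : Induces evP evP mu M) : IsPoissonConf br mu where
  lie :=
    { sesqui := hB.sesqui hP hP
      skew := fun a b => by
        have hfam : -B.opp = B := by ext α β a b; exact (h.skew α β a b).symm
        have hopp := (hB.opp hP).neg
        rw [hfam] at hopp
        exact hB.ext hP hopp a b
      jacobi := fun l m a b c => by
        revert l m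
        refine hP.ext_of_degrees fun α β γ => ?_
        have := h.jacobi α β γ (evP α a) (evP β b) (evP γ c)
        simp only [← hB.apply, neg_add] at this
        simpa only [add_assoc, add_left_comm β α, map_add] using this }
  assoc :=
    { sesqui := hM.sesqui hP hP
      assoc := fun l m a b c => by
        revert l m
        refine hP.ext_of_degrees fun α β γ => ?_
        have := h.assoc α β γ (evP α a) (evP β b) (evP γ c)
        simp only [← hM.apply, neg_add] at this
        simpa only [add_assoc] using this }
  comm := fun a b => by
    have hfam : M.opp = M := by ext α β a b; exact h.comm β α b a
    have hopp := hM.opp hP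
    rw [hfam] at hopp
    exact hM.ext hP hopp a b
  leibniz := fun l m a b c => by
    revert l m
    refine hP.ext_of_degrees fun α β γ => ?_
    have := h.leibniz α β γ (evP α a) (evP β b) (evP γ c)
    simp only [← hM.apply, ← hB.apply, neg_add] at this
    simpa only [add_assoc, add_left_comm β α, map_add] using this

theorem IsPrePoissonFam.isPrePoissonConf {ci su : LAct k P P} {C S : BilinFam k E E}
    (h : IsPrePoissonFam C S) (hP : IsFibration evP) (hC : Induces evP evP ci C)
    (hS : Induces evP evP su S) : IsPrePoissonConf ci su where
  zinbiel :=
    { sesqui := hS.sesqui hP hP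
      zinbiel := fun l m a b c => by
        revert l m
        refine hP.ext_of_degrees fun α β γ => ?_
        have := h.zinbiel α β γ (evP α a) (evP β b) (evP γ c)
        rw [← hS.lmNeg hP rfl (add_comm α β)] at this
        simp only [← hS.apply, neg_add, ← map_add] at this
        simpa only [add_assoc] using this }
  leftSymm :=
    { sesqui := hC.sesqui hP hP
      leftSymm := fun l m a b c => by
        revert l m
        refine hP.ext_of_degrees fun α β γ => ?_
        have := h.leftSymm α β γ (evP α a) (evP β b) (evP γ c)
        -- The product of `b` and `a` is read in degree `α + β` instead of `β + α`, as the outer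
        -- product requires.
        rw [← hC.lm rfl (add_comm α β)] at this
        simp only [← hC.apply, neg_add] at this
        simpa only [add_assoc, add_left_comm β α, map_sub] using this }
  compat₁ := fun l m a b c => by
    revert l m
    refine hP.ext_of_degrees fun α β γ => ?_
    have := h.compat₁ α β γ (evP α a) (evP β b) (evP γ c)
    rw [← hC.lmNeg hP rfl (add_comm α β), ← hC.apply, ← map_sub] at this
    simp only [← hC.apply, ← hS.apply, neg_add] at this
    simpa only [add_assoc, add_left_comm β α, map_sub] using this
  compat₂ := fun l m a b c => by
    revert l m
    refine hP.ext_of_degrees fun α β γ => ?_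
    have := h.compat₂ α β γ (evP α a) (evP β b) (evP γ c)
    rw [← hS.lmNeg hP rfl (add_comm α β), ← hS.apply, ← map_add] at this
    simp only [← hC.apply, ← hS.apply, neg_add] at this
    simpa only [add_assoc, add_left_comm β α, map_add] using this

theorem IsPoissonRepFam.isPoissonRep {br mu : LAct k P P} {ρ τ : LAct k P V}
    {B M : BilinFam k E E} {R T : BilinFam k E F} (h : IsPoissonRepFam B M R T)
    (hP : IsFibration evP) (hV : IsFibration evV) (hB : Induces evP evP br B)
    (hM : Induces evP evP mu M) (hR : Induces evP evV ρ R) (hT : Induces evP evV τ T) :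
    IsPoissonRep br mu ρ τ where
  lie :=
    { sesqui := hR.sesqui hP hV
      rep := fun l m a b c => by
        revert l m
        refine hV.ext_of_degrees fun α β γ => ?_
        have := h.rep α β γ (evP α a) (evP β b) (evV γ c)
        simp only [← hB.apply, ← hR.apply, neg_add] at this
        simpa only [add_assoc, add_left_comm β α, map_sub] using this }
  assoc :=
    { sesqui := hT.sesqui hP hV
      rep := fun l m a b c => by
        revert l m
        refine hV.ext_of_degrees fun α β γ => ?_
        have := h.mulRep α β γ (evP α a) (evP β b) (evV γ c)
        simp only [← hM.apply, ← hT.apply, neg_add] at this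
        simpa only [add_assoc] using this }
  compat₁ := fun l m a b v => by
    refine hV.sep.ext fun γ => ?_
    -- In this axiom `λ` enters through `-λ-∂`, so `-l` is the degree of `v` and not of `a`. The
    -- degree of `a` is `-m`, and `b` takes what remains of the total degree `γ`.
    have := h.compat₁ (-m) (γ + l + m) (-l) (evP (-m) a) (evP (γ + l + m) b) (evV (-l) v)
    rw [map_add, hR.lmNeg hV (α := -m + (γ + l + m)) (β := -l) (neg_neg l).symm (by ring),
      hM.lm (neg_neg m).symm rfl, this,
      hT.lmNeg hV (α := γ + l + m) (β := -m + -l) (by ring) (by ring),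
      hR.lmNeg hV (neg_neg l).symm rfl,
      hT.lm (α := -m) (β := γ + l + m + -l) (neg_neg m).symm (by ring),
      hR.lmNeg hV (neg_neg l).symm rfl]
  compat₂ := fun l m a b v => by
    revert l m
    refine hV.ext_of_degrees fun α β γ => ?_
    have := h.compat₂ α β γ (evP α a) (evP β b) (evV γ v)
    simp only [← hR.apply, ← hT.apply, ← hB.apply, neg_add] at this
    simpa only [add_assoc, add_left_comm β α, map_add] using this

end Conformal

/-! ## The fibres of free modules and of their conformal duals -/

section FreeFibres

variable {k : Type*} [Field k] {A V W : Type*} [AddCommGroup A] [Module k A]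
  [AddCommGroup V] [Module k V] [AddCommGroup W] [Module k W]

/-- The value `p(α)a` of `p(∂)a`. -/
def evFree (k A : Type*) [Field k] [AddCommGroup A] [Module k A] (α : k) :
    FreeMod k A →ₗ[k] A :=
  (TensorProduct.lid k A).toLinearMap ∘ₗ LinearMap.rTensor A (Polynomial.leval α)

theorem evFree_tmul (α : k) (p : k[X]) (a : A) : evFree k A α (p ⊗ₜ a) = p.eval α • a := by
  simp [evFree]

theorem evFree_inA (α : k) (a : A) : evFree k A α (inA k A a) = a := by
  simp [inA, evFree_tmul]

theorem isFibration_evFree [Infinite k] : IsFibration (evFree k A) where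
  del α v := by
    induction v using TensorProduct.induction_on with
    | zero => simp
    | add v w hv hw => simp only [map_add, hv, hw, smul_add]
    | tmul p a => simp [del_tmul, evFree_tmul, mul_smul]
  sep v hv := by
    have h : Separating (fun α : k => Polynomial.leval α) :=
      fun p hp => Polynomial.funext fun α => by simpa using hp α
    refine h.rTensor v fun α => (TensorProduct.lid k A).injective ?_
    rw [map_zero]
    exact hv α

theorem map_aeval_of_eigen (φ : V →ₗ[k] W) (T : Module.End k V) (c : k)
    (h : ∀ v, φ (T v) = c • φ v) (p : k[X]) (v : V) :
    φ (Polynomial.aeval T p v) = p.eval c • φ v := by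
  induction p using Polynomial.induction_on generalizing v with
  | C a => simp [Polynomial.aeval_C, Module.algebraMap_end_apply]
  | add p q hp hq => simp [hp, hq, add_smul]
  | monomial n a ih =>
    rw [pow_succ, ← mul_assoc, map_mul, Polynomial.aeval_X, Module.End.mul_apply, ih, h,
      smul_smul, Polynomial.eval_mul_X]

/-- On `p(∂)a` and `q(∂)b` the product is `p(-λ) q(∂+λ)` applied to `a_λ b`. At `λ = -α` over `α +
β` these factors are `p(α)` and `q(β)`, so only generators have to be checked. -/
theorem induces_extendProd [Infinite k] {φ : A →ₗ[k] A →ₗ[k] LPoly (FreeMod k A)}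
    {M : BilinFam k A A} (h : ∀ α β a b, evFree k A (α + β) (evalSc (-α) (φ a b)) = M α β a b) :
    Induces (evFree k A) (evFree k A) (extendProd φ) M := by
  intro α β x y
  induction x using TensorProduct.induction_on with
  | zero => simp [lm]
  | add x x' hx hx' =>
    simp only [lm, map_add, LinearMap.add_apply] at hx hx' ⊢
    rw [hx, hx']
  | tmul p a =>
    induction y using TensorProduct.induction_on with
    | zero => simp [lm]
    | add y y' hy hy' =>
      simp only [lm, map_add] at hy hy' ⊢
      rw [hy, hy']
    | tmul q b =>
      rw [lm, extendProd_tmul, ← LinearMap.comp_apply (evFree k A (α + β)),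
        map_aeval_of_eigen _ _ α, map_aeval_of_eigen _ _ β, LinearMap.comp_apply, h,
        evFree_tmul, evFree_tmul, map_smul, map_smul, LinearMap.smul_apply,
        smul_comm]
      · intro w
        simp only [LinearMap.comp_apply, LinearMap.add_apply, map_add, evalSc_mulLam,
          evalSc_delPoly, isFibration_evFree.del, map_smul, ← add_smul]
        congr 1
        ring
      · intro w
        simp [evalSc_mulLam]

/-- The family of products on the fibres of `k[∂] ⊗ A` induced by `∘_λ`. -/
def circFam (lhd rhd dia : A →ₗ[k] A →ₗ[k] A) : BilinFam k A A :=
  fun α β => β • lhd.flip - α • rhd + dia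

theorem circFam_apply (lhd rhd dia : A →ₗ[k] A →ₗ[k] A) (α β : k) (a b : A) :
    circFam lhd rhd dia α β a b = β • lhd b a - α • rhd a b + dia a b := rfl

/-- Setting `∂ = α + β` and `λ = -α` in the defining formula leaves `b ◁ a` with coefficient `β` and
`a ▷ b` with coefficient `-α`. -/
theorem induces_circProd [Infinite k] (lhd rhd dia : A →ₗ[k] A →ₗ[k] A) :
    Induces (evFree k A) (evFree k A) (circProd lhd rhd dia) (circFam lhd rhd dia) := by
  refine induces_extendProd fun α β a b => ?_
  simp only [LinearMap.add_apply, LinearMap.compr₂_apply, LinearMap.comp_apply, map_add,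
    Finsupp.lsingle_apply, evalSc, evalAt_single, pow_zero, pow_one, Module.End.one_apply,
    isFibration_evFree.del, evFree_inA, LinearMap.smul_apply, map_smul, LinearMap.flip_apply,
    circFam_apply]
  module

theorem induces_succProd [Infinite k] (su : A →ₗ[k] A →ₗ[k] A) :
    Induces (evFree k A) (evFree k A) (succProd su) (fun _ _ => su) := by
  refine induces_extendProd fun α β a b => ?_
  simp [evalSc, evalAt_single, evFree_inA]

/-- Each graded axiom compares two polynomials in the degrees whose coefficients are accounted for
by the pre-PGD axioms: terms without degrees give the pre-Poisson axioms of `◇` and `≻`, quadratic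
ones the pre-Novikov axioms, and linear ones the mixed compatibilities. -/
theorem IsPrePGD.isPrePoissonFam {lhd rhd su dia : A →ₗ[k] A →ₗ[k] A}
    (h : IsPrePGD lhd rhd su dia) :
    IsPrePoissonFam (circFam lhd rhd dia) (fun _ _ => su) where
  leftSymm α β γ a b c := by
    have n1 := h.preGD.preNovikov.nd₁ a b c
    have n2 := h.preGD.preNovikov.nd₂ a c b
    have n2' := h.preGD.preNovikov.nd₂ b c a
    have n3 := h.preGD.preNovikov.nd₃ a b c
    have n3' := h.preGD.preNovikov.nd₃ b a c
    have n4 := h.preGD.preNovikov.nd₄ c a b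
    have l := h.preGD.leftSymm a b c
    have c1 := h.preGD.compat₁ a b c
    have c2 := h.preGD.compat₂ a b c
    have c2' := h.preGD.compat₂ b a c
    simp only [circFam_apply, map_add, map_sub, LinearMap.add_apply, LinearMap.sub_apply,
      LinearMap.smul_apply, map_smul] at *
    -- Each axiom is multiplied by the monomial in `α`, `β`, `γ` whose coefficient it makes vanish.
    linear_combination (norm := module) (α * β) • n1 - l - γ ^ 2 • n4 + (β * γ) • n2'
      - (α * γ) • n2 + β ^ 2 • n3' - α ^ 2 • n3 - γ • c1 - β • c2' + α • c2
  zinbiel α β γ a b c := by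
    rw [add_comm (su a b)]
    exact h.prePoisson.zinbiel a b c
  compat₁ α β γ a b c := by
    have p1 := h.prePoisson.compat₁ a b c
    have d2 := h.preDNP.compat₂ b a c
    have d3 := h.preDNP.compat₃ b a c
    have d3' := h.preDNP.compat₃ a b c
    have d4 := h.preDNP.compat₄ a b c
    simp only [circFam_apply, map_add, map_sub, LinearMap.add_apply, LinearMap.sub_apply,
      LinearMap.smul_apply, map_smul] at *
    linear_combination (norm := module) p1 - (β + γ) • d2 - β • d3 + α • d4
  compat₂ α β γ a b c := by
    have p2 := h.prePoisson.compat₂ a b c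
    have d1 := h.preDNP.compat₁ a b c
    have d1' := h.preDNP.compat₁ b a c
    have d5 := h.preDNP.compat₅ a b c
    simp only [circFam_apply, map_add, map_sub, LinearMap.add_apply, map_smul] at *
    linear_combination (norm := module) p2 + γ • d5 - β • d1 - α • d1'

/-- The value of `f` at the fibre at `α`, a functional on `A`. As `∂` acts on the conformal dual
by `-λ`, it is `f_λ` at `λ = -α`. -/
def evDual (k A : Type*) [Field k] [AddCommGroup A] [Module k A] (α : k) :
    ConfDual k (FreeMod k A) →ₗ[k] (A →ₗ[k] k) where
  toFun f := Polynomial.leval (-α) ∘ₗ f.toLin ∘ₗ inA k A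
  map_add' f g := by ext; simp
  map_smul' c f := by ext; simp

theorem evDual_apply (α : k) (f : ConfDual k (FreeMod k A)) (a : A) :
    evDual k A α f a = (f.toLin (inA k A a)).eval (-α) := rfl

theorem ConfDual.toLin_tmul (f : ConfDual k (FreeMod k A)) (p : k[X]) (a : A) :
    f.toLin (p ⊗ₜ a) = p * f.toLin (inA k A a) := by
  induction p using Polynomial.induction_on with
  | C c =>
    rw [show (Polynomial.C c : k[X]) ⊗ₜ[k] a = c • inA k A a by
      rw [inA, TensorProduct.mk_apply, TensorProduct.smul_tmul', Polynomial.smul_eq_C_mul,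
        mul_one], map_smul, Polynomial.smul_eq_C_mul]
  | add p q hp hq => rw [TensorProduct.add_tmul, map_add, hp, hq, add_mul]
  | monomial n c ih =>
    rw [show (Polynomial.C c * Polynomial.X ^ (n + 1) : k[X]) ⊗ₜ[k] a
        = del k _ ((Polynomial.C c * Polynomial.X ^ n) ⊗ₜ[k] a) by rw [del_tmul]; ring_nf,
      ConfDual.toLin_del, ih]
    ring

/-- The conformal pairing `f_λ(x)` at `λ = d` is the ordinary pairing of opposite fibres, `-d` for
`f` and `d` for `x`. -/
theorem evDual_evFree (d : k) (f : ConfDual k (FreeMod k A)) (x : FreeMod k A) :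
    evDual k A (-d) f (evFree k A d x) = (f.toLin x).eval d := by
  induction x using TensorProduct.induction_on with
  | zero => simp
  | add x y hx hy => simp only [map_add, hx, hy, Polynomial.eval_add]
  | tmul p a => simp [evFree_tmul, f.toLin_tmul, evDual_apply]

theorem isFibration_evDual [Infinite k] : IsFibration (evDual k A) where
  del α f := by
    ext a
    simp [evDual_apply, ConfDual.del_apply]
  sep f hf := by
    refine ConfDual.ext fun v => Polynomial.funext fun d => ?_
    rw [← evDual_evFree, hf]
    simp

theorem evDual_inDual (α : k) (f : Module.Dual k A) : evDual k A α (inDual f) = f := by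
  ext a
  simp [evDual_apply, inA, inDual_tmul]

/-- In `-f_{μ-λ}(ρ(a)_λ v)` put `λ = -α` and `μ = -(α + β)`. Then `μ - λ = -β`, so the functional
comes from the fibre of `f` at `β`, and `v` is taken over `-(α + β)`, as in `BilinFam.dual`. -/
theorem Induces.dualAct [FiniteDimensional k A]
    {ρ : LAct k (FreeMod k A) (FreeMod k A)} {M : BilinFam k A A}
    (h : Induces (evFree k A) (evFree k A) ρ M) (hρ : Sesqui ρ) :
    Induces (evFree k A) (evDual k A) (dualAct hρ) M.dual := by
  intro α β a f
  refine LinearMap.ext fun v => ?_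
  rw [evDual_apply, dualAct_apply, BilinFam.dual_apply, ← evDual_evFree,
    h.lm (β := -(α + β)) rfl (by ring), evFree_inA]
  simp

end FreeFibres

/-! ### Fibres of direct sums and of semi-direct products. -/

section ProductFibres

variable {k : Type*} [Field k] {P V E F : Type*}
  [AddCommGroup P] [Module k P] [AddCommGroup V] [Module k V] [Module k[X] V]
  [IsScalarTower k k[X] V] [AddCommGroup E] [Module k E] [AddCommGroup F] [Module k F]
  {evP : k → P →ₗ[k] E} {evV : k → V →ₗ[k] F}

theorem IsFibration.prodMap [Module k[X] P] [IsScalarTower k k[X] P] (hP : IsFibration evP) (hV : IsFibration evV) :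
    IsFibration fun α => (evP α).prodMap (evV α) where
  del α v := Prod.ext (hP.del α v.1) (hV.del α v.2)
  sep _ hv := Prod.ext (hP.sep _ fun α => (Prod.ext_iff.mp (hv α)).1)
    (hV.sep _ fun α => (Prod.ext_iff.mp (hv α)).2)

theorem Induces.semiBr {br : LAct k P P} {ρ : LAct k P V} {B : BilinFam k E E}
    {R : BilinFam k E F} (hB : Induces evP evP br B) (hR : Induces evP evV ρ R)
    (hV : IsFibration evV) :
    Induces (fun α => (evP α).prodMap (evV α)) (fun α => (evP α).prodMap (evV α))
      (semiBr br ρ) (semiBrFam B R) := by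
  intro α β p q
  have h1 := hB α β p.1 q.1
  have h2 := hR α β p.1 q.2
  have h3 := hR.lmNeg hV rfl (add_comm α β) q.1 p.2
  simp only [PConf.lm, PConf.lmNeg] at h1 h2 h3
  simp only [PConf.lm, PConf.semiBr, LinearMap.mk₂_apply, map_add, map_sub, evalSc_onCoeff,
    semiBrFam_apply, LinearMap.prodMap_apply, LinearMap.inl_apply, LinearMap.inr_apply]
  ext1
  · simp [h1]
  · simp [h2, h3]

theorem Induces.semiMul {mu : LAct k P P} {τ : LAct k P V} {M : BilinFam k E E}
    {T : BilinFam k E F} (hM : Induces evP evP mu M) (hT : Induces evP evV τ T)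
    (hV : IsFibration evV) :
    Induces (fun α => (evP α).prodMap (evV α)) (fun α => (evP α).prodMap (evV α))
      (semiMul mu τ) (semiMulFam M T) := by
  intro α β p q
  have h1 := hM α β p.1 q.1
  have h2 := hT α β p.1 q.2
  have h3 := hT.lmNeg hV rfl (add_comm α β) q.1 p.2
  simp only [PConf.lm, PConf.lmNeg] at h1 h2 h3
  simp only [PConf.lm, PConf.semiMul, LinearMap.mk₂_apply, map_add, evalSc_onCoeff,
    semiMulFam_apply, LinearMap.prodMap_apply, LinearMap.inl_apply, LinearMap.inr_apply]
  ext1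
  · simp [h1]
  · simp [h2, h3]

end ProductFibres

/-! ## Coboundary bialgebras from a symplectic form -/

section Pairings

variable {k : Type*} [Field k] {V W X V' W' : Type*} [AddCommGroup V] [Module k V]
  [AddCommGroup W] [Module k W] [AddCommGroup X] [Module k X]
  [AddCommGroup V'] [Module k V'] [AddCommGroup W'] [Module k W'] {ι κ : Type*}

/-- The functional `φ ⊗ ψ` on a tensor product. -/
def pairT (φ : V →ₗ[k] k) (ψ : W →ₗ[k] k) : V ⊗[k] W →ₗ[k] k :=
  (TensorProduct.lid k k).toLinearMap ∘ₗ TensorProduct.map φ ψ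

theorem pairT_tmul (φ : V →ₗ[k] k) (ψ : W →ₗ[k] k) (v : V) (w : W) :
    pairT φ ψ (v ⊗ₜ w) = φ v * ψ w := rfl

theorem Separating.pairT {φ : ι → V →ₗ[k] k} {ψ : κ → W →ₗ[k] k} (h : Separating φ)
    (h' : Separating ψ) : Separating fun p : ι × κ => pairT (φ p.1) (ψ p.2) := by
  intro t ht
  refine h.map h' t fun p => (TensorProduct.lid k k).injective ?_
  rw [map_zero]
  exact ht p

theorem pairT_map (φ : V →ₗ[k] k) (ψ : W →ₗ[k] k) (f : V' →ₗ[k] V) (g : W' →ₗ[k] W)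
    (t : V' ⊗[k] W') :
    pairT φ ψ (TensorProduct.map f g t) = pairT (φ ∘ₗ f) (ψ ∘ₗ g) t := by
  rw [pairT, LinearMap.comp_apply, ← LinearMap.comp_apply (TensorProduct.map φ ψ),
    ← TensorProduct.map_comp]
  rfl

theorem pairT_rTensor (φ : V →ₗ[k] k) (ψ : W →ₗ[k] k) (f : V' →ₗ[k] V) (t : V' ⊗[k] W) :
    pairT φ ψ (LinearMap.rTensor W f t) = pairT (φ ∘ₗ f) ψ t :=
  pairT_map φ ψ f LinearMap.id t

theorem pairT_lTensor (φ : V →ₗ[k] k) (ψ : W →ₗ[k] k) (g : W' →ₗ[k] W) (t : V ⊗[k] W') :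
    pairT φ ψ (LinearMap.lTensor V g t) = pairT φ (ψ ∘ₗ g) t :=
  pairT_map φ ψ LinearMap.id g t

theorem pairT_comm (φ : V →ₗ[k] k) (ψ : W →ₗ[k] k) (t : W ⊗[k] V) :
    pairT φ ψ (TensorProduct.comm k W V t) = pairT ψ φ t := by
  induction t using TensorProduct.induction_on with
  | zero => simp
  | add x y hx hy => simp only [map_add, hx, hy]
  | tmul w v => simp [pairT_tmul, mul_comm]

theorem pairT_assoc (φ : V →ₗ[k] k) (ψ : W →ₗ[k] k) (χ : X →ₗ[k] k) (t : (V ⊗[k] W) ⊗[k] X) :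
    pairT φ (pairT ψ χ) (TensorProduct.assoc k V W X t) = pairT (pairT φ ψ) χ t := by
  induction t using TensorProduct.induction_on with
  | zero => simp
  | add x y hx hy => simp only [map_add, hx, hy]
  | tmul t x =>
    induction t using TensorProduct.induction_on with
    | zero => simp
    | add y z hy hz => simp only [TensorProduct.add_tmul, map_add, hy, hz]
    | tmul v w => simp [pairT_tmul, mul_assoc]

theorem pairT_leftComm (φ : V →ₗ[k] k) (ψ : W →ₗ[k] k) (χ : X →ₗ[k] k) (t : W ⊗[k] (V ⊗[k] X)) :
    pairT φ (pairT ψ χ) (TensorProduct.leftComm k W V X t) = pairT ψ (pairT φ χ) t := by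
  induction t using TensorProduct.induction_on with
  | zero => simp
  | add x y hx hy => simp only [map_add, hx, hy]
  | tmul w t =>
    induction t using TensorProduct.induction_on with
    | zero => simp
    | add y z hy hz => simp only [TensorProduct.tmul_add, map_add, hy, hz]
    | tmul v x => simp only [TensorProduct.leftComm_tmul, pairT_tmul]; ring

/-- `R` is the inverse of the bilinear form `ω`. -/
structure IsInverseTensor (ω : V →ₗ[k] V →ₗ[k] k) (R : V ⊗[k] V) : Prop where
  left : ∀ v φ, pairT (ω v) φ R = φ v
  right : ∀ v φ, pairT φ (ω v) R = -φ v

theorem comm_map (f : V →ₗ[k] V') (g : W →ₗ[k] W') (t : W ⊗[k] V) :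
    TensorProduct.map f g (TensorProduct.comm k W V t)
      = TensorProduct.comm k W' V' (TensorProduct.map g f t) :=
  TensorProduct.map_comm f g t

theorem comm_rTensor (f : V →ₗ[k] V') (t : V ⊗[k] W) :
    TensorProduct.comm k V' W (LinearMap.rTensor W f t)
      = LinearMap.lTensor W f (TensorProduct.comm k V W t) :=
  (comm_map LinearMap.id f t).symm

theorem comm_lTensor (f : V →ₗ[k] V') (t : W ⊗[k] V) :
    TensorProduct.comm k W V' (LinearMap.lTensor W f t)
      = LinearMap.rTensor W f (TensorProduct.comm k W V t) :=
  (comm_map f LinearMap.id t).symm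

end Pairings

/-! ### Consequences of the graded Poisson axioms. -/

section PoissonFamilies

variable {k : Type*} [Field k] {E : Type*} [AddCommGroup E] [Module k E] {B M : BilinFam k E E}

theorem IsPoissonFam.mul_left_comm (h : IsPoissonFam B M) (α β γ : k) (a b c : E) :
    M α (β + γ) a (M β γ b c) = M β (α + γ) b (M α γ a c) := by
  rw [← h.assoc, ← h.assoc, h.comm α β, add_comm α β]

theorem IsPoissonFam.leibniz_left (h : IsPoissonFam B M) (α β γ : k) (a b c : E) :
    B (α + β) γ (M α β a b) c = M α (β + γ) a (B β γ b c) + M β (α + γ) b (B α γ a c) := by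
  rw [h.skew, h.leibniz, h.skew γ, h.skew γ, h.comm (γ + α), add_comm γ, add_comm γ]
  simp only [map_neg]
  abel

/-- When both terms are expanded by the Leibniz rule, the two products with `B α β a b` and `B β α b
a` cancel by skew-symmetry. The identity serves in the second leg of the mixed condition on `δ(a_λ
b)`. -/
theorem IsPoissonFam.leibniz_symm (h : IsPoissonFam B M) (α β γ : k) (a b c : E) :
    B α (β + γ) a (M β γ b c) + B β (α + γ) b (M α γ a c)
      = M α (β + γ) a (B β γ b c) + M β (α + γ) b (B α γ a c) := by
  rw [h.leibniz, h.leibniz, h.skew β α, add_comm β α, map_neg, LinearMap.neg_apply]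
  abel

end PoissonFamilies

/-! ### Poisson coalgebras by transposing graded Poisson algebras. -/

section Coalgebras

variable {k : Type*} [Field k] {P E : Type*}
  [AddCommGroup P] [Module k P] [AddCommGroup E] [Module k E]
  {ev : k → P →ₗ[k] E} {ω : E →ₗ[k] E →ₗ[k] k}

/-- The coproduct `δ` is dual to the family of products `M` with respect to `ω`. -/
def IsDualTo (ev : k → P →ₗ[k] E) (ω : E →ₗ[k] E →ₗ[k] k) (δ : P →ₗ[k] P ⊗[k] P)
    (M : BilinFam k E E) : Prop :=
  ∀ x y v w a, pairT (ω v ∘ₗ ev x) (ω w ∘ₗ ev y) (δ a) = -ω (ev (x + y) a) (M (-x) (-y) v w)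

variable {δ Δ : P →ₗ[k] P ⊗[k] P} {B M : BilinFam k E E}
  (hskew : ∀ u v, ω u v = -ω v u)

include hskew in
-- The inner coproduct, paired with `ω w` and `ω s`, is the functional `ω (M w s)` of the sum of the
-- two degrees; skew-symmetry of `ω` absorbs the sign. Duality of the outer coproduct then applies.
theorem IsDualTo.coIter₂ (hδ : IsDualTo ev ω δ B) (hΔ : IsDualTo ev ω Δ M) (x y z : k)
    (v w s : E) (a : P) :
    pairT (ω v ∘ₗ ev x) (pairT (ω w ∘ₗ ev y) (ω s ∘ₗ ev z)) (coIter₂ δ Δ a)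
      = -ω (ev (x + y + z) a) (B (-x) (-y + -z) v (M (-y) (-z) w s)) := by
  have : pairT (ω w ∘ₗ ev y) (ω s ∘ₗ ev z) ∘ₗ Δ = ω (M (-y) (-z) w s) ∘ₗ ev (y + z) := by
    ext b
    rw [LinearMap.comp_apply, hΔ, ← hskew]
    rfl
  rw [PConf.coIter₂, pairT_lTensor, this, hδ, neg_add, add_assoc]

include hskew in
theorem IsDualTo.coIter₁ (hδ : IsDualTo ev ω δ B) (hΔ : IsDualTo ev ω Δ M) (x y z : k)
    (v w s : E) (a : P) :
    pairT (ω v ∘ₗ ev x) (pairT (ω w ∘ₗ ev y) (ω s ∘ₗ ev z)) (coIter₁ δ Δ a)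
      = -ω (ev (x + y + z) a) (B (-x + -y) (-z) (M (-x) (-y) v w) s) := by
  have : pairT (ω v ∘ₗ ev x) (ω w ∘ₗ ev y) ∘ₗ Δ = ω (M (-x) (-y) v w) ∘ₗ ev (x + y) := by
    ext b
    rw [LinearMap.comp_apply, hΔ, ← hskew]
    rfl
  rw [PConf.coIter₁, pairT_assoc, pairT_rTensor, this, hδ, neg_add]

variable [Module k[X] P] [IsScalarTower k k[X] P]

theorem map_delTwo (hP : IsFibration ev) (x y : k) (t : P ⊗[k] P) :
    TensorProduct.map (ev x) (ev y) (delTwo k P t)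
      = (x + y) • TensorProduct.map (ev x) (ev y) t := by
  induction t using TensorProduct.induction_on with
  | zero => simp
  | add t u ht hu => simp only [map_add, ht, hu, smul_add]
  | tmul a b =>
    simp [delTwo, hP.del, add_smul, TensorProduct.smul_tmul']

theorem ext_pairT_two (hP : IsFibration ev) (hω : Separating ω) {t u : P ⊗[k] P}
    (h : ∀ x y v w, pairT (ω v ∘ₗ ev x) (ω w ∘ₗ ev y) t = pairT (ω v ∘ₗ ev x) (ω w ∘ₗ ev y) u) :
    t = u :=
  ((hP.sep.comp hω).pairT (hP.sep.comp hω)).ext fun p => h p.1.1 p.2.1 p.1.2 p.2.2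

theorem ext_pairT_three (hP : IsFibration ev) (hω : Separating ω) {t u : P ⊗[k] (P ⊗[k] P)}
    (h : ∀ x y z v w s,
      pairT (ω v ∘ₗ ev x) (pairT (ω w ∘ₗ ev y) (ω s ∘ₗ ev z)) t
        = pairT (ω v ∘ₗ ev x) (pairT (ω w ∘ₗ ev y) (ω s ∘ₗ ev z)) u) : t = u :=
  ((hP.sep.comp hω).pairT ((hP.sep.comp hω).pairT (hP.sep.comp hω))).ext fun p =>
    h p.1.1 p.2.1.1 p.2.2.1 p.1.2 p.2.1.2 p.2.2.2

theorem IsDualTo.hom (h : IsDualTo ev ω δ B) (hP : IsFibration ev) (hω : Separating ω) (a : P) :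
    δ (del k P a) = delTwo k P (δ a) := by
  refine ext_pairT_two hP hω fun x y v w => ?_
  rw [h, ← pairT_map _ _ (ev x), map_delTwo hP, map_smul, pairT_map, h, hP.del]
  simp

include hskew in
-- Tensors are compared by pairing with functionals `ω v` on fibres; this turns iterated coproducts
-- into iterated products and each coalgebra axiom into the matching Poisson axiom.
theorem IsPoissonFam.isPoissonConfCoalg (h : IsPoissonFam B M) (hP : IsFibration ev)
    (hω : Separating ω) (hδ : IsDualTo ev ω δ B) (hΔ : IsDualTo ev ω Δ M) :
    IsPoissonConfCoalg δ Δ where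
  lie :=
    { hom := hδ.hom hP hω
      skew := fun a => ext_pairT_two hP hω fun x y v w => by
        rw [map_neg, pairT_comm, hδ, hδ, h.skew, map_neg, add_comm y]
      coJacobi := fun a => ext_pairT_three hP hω fun x y z v w s => by
        rw [map_sub, pairT_leftComm, hδ.coIter₂ hskew hδ, hδ.coIter₂ hskew hδ,
          hδ.coIter₁ hskew hδ, h.jacobi, add_comm y, map_add]
        ring }
  assoc :=
    { hom := hΔ.hom hP hω
      coassoc := fun a => ext_pairT_three hP hω fun x y z v w s => by
        rw [hΔ.coIter₂ hskew hΔ, hΔ.coIter₁ hskew hΔ, h.assoc] }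
  cocomm := fun a => ext_pairT_two hP hω fun x y v w => by
    rw [pairT_comm, hΔ, hΔ, h.comm, add_comm y]
  compat := fun a => ext_pairT_three hP hω fun x y z v w s => by
    rw [map_add, pairT_leftComm, hδ.coIter₂ hskew hΔ, hΔ.coIter₂ hskew hδ,
      hΔ.coIter₁ hskew hδ, h.leibniz, add_comm y, map_add]
    ring

end Coalgebras

/-! ### Coboundary coproducts and the bialgebra conditions. -/

section Coboundaries

variable {k : Type*} [Field k] {P E : Type*}
  [AddCommGroup P] [Module k P]
  [AddCommGroup E] [Module k E] {ev : k → P →ₗ[k] E} {ω : E →ₗ[k] E →ₗ[k] k}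
  {ρ br mu : LAct k P P} {B M N : BilinFam k E E} {r : P ⊗[k] P} {R : E ⊗[k] E}

theorem Induces.map_onLeft (h : Induces ev ev ρ M) {α β x c : k} (hc : c = -α) (hx : x = α + β)
    (y : k) (a : P) (t : P ⊗[k] P) :
    TensorProduct.map (ev x) (ev y) (evalSc c (onLeft P (ρ a) t))
      = LinearMap.rTensor E (M α β (ev α a)) (TensorProduct.map (ev β) (ev y) t) := by
  rw [evalSc_onLeft]
  induction t using TensorProduct.induction_on with
  | zero => simp
  | add t u ht hu => simp only [map_add, ht, hu]
  | tmul b d =>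
    simp only [LinearMap.rTensor_tmul, TensorProduct.map_tmul]
    rw [← h.lm hc hx]
    rfl

theorem Induces.map_onRight (h : Induces ev ev ρ M) {α β y c : k} (hc : c = -α) (hy : y = α + β)
    (x : k) (a : P) (t : P ⊗[k] P) :
    TensorProduct.map (ev x) (ev y) (evalSc c (onRight P (ρ a) t))
      = LinearMap.lTensor E (M α β (ev α a)) (TensorProduct.map (ev x) (ev β) t) := by
  rw [evalSc_onRight]
  induction t using TensorProduct.induction_on with
  | zero => simp
  | add t u ht hu => simp only [map_add, ht, hu]
  | tmul b d =>
    simp only [LinearMap.lTensor_tmul, TensorProduct.map_tmul]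
    rw [← h.lm hc hy]
    rfl

theorem Induces.degrees_actL {α β p q : k} (hsum : α + β + p + q = 0)
    (h : Induces ev ev ρ N) (a : P) (t : P ⊗[k] P) :
    TensorProduct.map (ev (-q)) (ev (-p)) (actL (ρ a) (-α) t)
      = LinearMap.rTensor E (N α (β + p) (ev α a))
        (TensorProduct.map (ev (β + p)) (ev (-p)) t) :=
  h.map_onLeft rfl (by linear_combination -hsum) _ a t

theorem Induces.degrees_actR {α β p q : k} (hsum : α + β + p + q = 0)
    (h : Induces ev ev ρ N) (a : P) (t : P ⊗[k] P) :
    TensorProduct.map (ev (-q)) (ev (-p)) (actR (ρ a) (-α) t)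
      = LinearMap.lTensor E (N α (β + q) (ev α a))
        (TensorProduct.map (ev (-q)) (ev (β + q)) t) :=
  h.map_onRight rfl (by linear_combination -hsum) _ a t

variable [Module k[X] P] [IsScalarTower k k[X] P]

theorem Induces.map_actNegL (h : Induces ev ev ρ M) (hP : IsFibration ev) {α β x y c : k}
    (hc : c = α - x - y) (hx : x = α + β) (a : P) (t : P ⊗[k] P) :
    TensorProduct.map (ev x) (ev y) (actNegL (ρ a) c t)
      = LinearMap.rTensor E (M α β (ev α a)) (TensorProduct.map (ev β) (ev y) t) := by
  rw [actNegL, map_evalAt_of_eigen _ _ (-c - (x + y))]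
  · exact h.map_onLeft (by rw [hc]; ring) hx _ a t
  · intro t
    rw [LinearMap.sub_apply, LinearMap.neg_apply, map_sub, map_neg, map_delTwo hP]
    simp [sub_smul]

theorem Induces.map_actNegR (h : Induces ev ev ρ M) (hP : IsFibration ev) {α β x y c : k}
    (hc : c = α - x - y) (hy : y = α + β) (a : P) (t : P ⊗[k] P) :
    TensorProduct.map (ev x) (ev y) (actNegR (ρ a) c t)
      = LinearMap.lTensor E (M α β (ev α a)) (TensorProduct.map (ev x) (ev β) t) := by
  rw [actNegR, map_evalAt_of_eigen _ _ (-c - (x + y))]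
  · exact h.map_onRight (by rw [hc]; ring) hy _ a t
  · intro t
    rw [LinearMap.sub_apply, LinearMap.neg_apply, map_sub, map_neg, map_delTwo hP]
    simp [sub_smul]

/-- `r` has the value `R` on every product of fibres of total degree zero. -/
def IsConstantTensor (ev : k → P →ₗ[k] E) (r : P ⊗[k] P) (R : E ⊗[k] E) : Prop :=
  ∀ x y, x + y = 0 → TensorProduct.map (ev x) (ev y) r = R

/-- On the fibre at `(x, y)` the substitution `λ = -∂^{⊗2}` is `-(x + y)`, so `a` is taken in degree
`α = x + y`. The factor it acts on starts in degree `-y` or `-x`, so `r` is only evaluated in total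
degree zero, where it is `R`. -/
theorem Induces.map_coboundaryLie (hB : Induces ev ev br B) (hP : IsFibration ev)
    (hr : IsConstantTensor ev r R) {x y α p q : k} (hα : x + y = α) (hp : y = -p) (hq : x = -q)
    (a : P) :
    TensorProduct.map (ev x) (ev y) (coboundaryLie br r a)
      = LinearMap.rTensor E (B α p (ev α a)) R + LinearMap.lTensor E (B α q (ev α a)) R := by
  change TensorProduct.map (ev x) (ev y)
    (evalAt (-delTwo k P) (onLeft P (br a) r + onRight P (br a) r)) = _
  rw [map_evalAt_of_eigen _ _ (-α), map_add,
    map_add, hB.map_onLeft (α := α) (β := p) rfl (by rw [← hα, hp]; ring),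
    hB.map_onRight (α := α) (β := q) rfl (by rw [← hα, hq]; ring),
    hr p y (by rw [hp]; ring), hr x q (by rw [hq]; ring)]
  intro t
  rw [LinearMap.neg_apply, map_neg, map_delTwo hP, hα, neg_smul]

theorem Induces.map_coboundaryMul (hM : Induces ev ev mu M) (hP : IsFibration ev)
    (hr : IsConstantTensor ev r R) {x y α p q : k} (hα : x + y = α) (hp : y = -p) (hq : x = -q)
    (a : P) :
    TensorProduct.map (ev x) (ev y) (coboundaryMul mu r a)
      = LinearMap.lTensor E (M α q (ev α a)) R - LinearMap.rTensor E (M α p (ev α a)) R := by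
  change TensorProduct.map (ev x) (ev y)
    (evalAt (-delTwo k P) (onRight P (mu a) r - onLeft P (mu a) r)) = _
  rw [map_evalAt_of_eigen _ _ (-α), map_sub,
    map_sub, hM.map_onLeft (α := α) (β := p) rfl (by rw [← hα, hp]; ring),
    hM.map_onRight (α := α) (β := q) rfl (by rw [← hα, hq]; ring),
    hr p y (by rw [hp]; ring), hr x q (by rw [hq]; ring)]
  intro t
  rw [LinearMap.neg_apply, map_neg, map_delTwo hP, hα, neg_smul]

/-- As `R` inverts `ω`, pairing `δ(a)` with `ω v` and `ω w` gives `ω(w, [a, v]) - ω(v, [a, w])`. The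
cocycle identity rewrites this as `-ω(a, [v, w])`. -/
theorem Induces.isDualTo_coboundaryLie (hB : Induces ev ev br B) (hP : IsFibration ev)
    (hr : IsConstantTensor ev r R) (hR : IsInverseTensor ω R) (hω : IsCocycleFor ω B)
    (hskew : ∀ α β a b, B α β a b = -B β α b a) : IsDualTo ev ω (coboundaryLie br r) B := by
  intro x y v w a
  rw [← pairT_map, hB.map_coboundaryLie hP hr rfl (neg_neg y).symm (neg_neg x).symm, map_add,
    pairT_rTensor, pairT_lTensor, hR.left, hR.right]
  have h1 := hω (x + y) (-x) (-y) (ev (x + y) a) v w (by ring)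
  rw [hskew (-y) (x + y), map_neg] at h1
  simp only [LinearMap.comp_apply]
  linear_combination h1

theorem Induces.isDualTo_coboundaryMul (hM : Induces ev ev mu M) (hP : IsFibration ev)
    (hr : IsConstantTensor ev r R) (hR : IsInverseTensor ω R) (hω : IsCocycleFor ω M)
    (hcomm : ∀ α β a b, M α β a b = M β α b a) : IsDualTo ev ω (coboundaryMul mu r) M := by
  intro x y v w a
  rw [← pairT_map, hM.map_coboundaryMul hP hr rfl (neg_neg y).symm (neg_neg x).symm, map_sub,
    pairT_rTensor, pairT_lTensor, hR.left, hR.right]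
  have h1 := hω (x + y) (-x) (-y) (ev (x + y) a) v w (by ring)
  rw [hcomm (-y) (x + y)] at h1
  simp only [LinearMap.comp_apply]
  linear_combination h1

/-- An equality in `P ⊗ P` depending on a scalar may be checked on fibres. The scalar is minus the
degree `α` of a first argument, `β` is the degree of a second one, and `q`, `p` are minus the
degrees of the two tensor factors. -/
theorem IsFibration.ext_tensor_of_degrees (hP : IsFibration ev) {f g : k → P ⊗[k] P}
    (h : ∀ α β p q, α + β + p + q = 0 → TensorProduct.map (ev (-q)) (ev (-p)) (f (-α))
      = TensorProduct.map (ev (-q)) (ev (-p)) (g (-α))) (l : k) : f l = g l := by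
  refine (hP.sep.map hP.sep).ext fun ⟨x, y⟩ => ?_
  have := h (-l) (x + y + l) (-y) (-x) (by ring)
  rwa [neg_neg, neg_neg, neg_neg] at this

section Degrees

variable {α β p q : k} (hsum : α + β + p + q = 0)

include hsum

theorem Induces.degrees_actNegL (h : Induces ev ev ρ N) (hP : IsFibration ev) (b : P)
    (t : P ⊗[k] P) :
    TensorProduct.map (ev (-q)) (ev (-p)) (actNegL (ρ b) (-α) t)
      = LinearMap.rTensor E (N β (α + p) (ev β b))
        (TensorProduct.map (ev (α + p)) (ev (-p)) t) :=
  h.map_actNegL hP (by linear_combination -hsum) (by linear_combination -hsum) b t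

theorem Induces.degrees_actNegR (h : Induces ev ev ρ N) (hP : IsFibration ev) (b : P)
    (t : P ⊗[k] P) :
    TensorProduct.map (ev (-q)) (ev (-p)) (actNegR (ρ b) (-α) t)
      = LinearMap.lTensor E (N β (α + q) (ev β b))
        (TensorProduct.map (ev (-q)) (ev (α + q)) t) :=
  h.map_actNegR hP (by linear_combination -hsum) (by linear_combination -hsum) b t

/-- The five pairs of fibres met in the bialgebra conditions: one for the coproduct of a product of
degree `α + β`, two for an element of degree `α` whose coproduct is acted on, in its left or right
factor, by one of degree `β`, and two with these roles exchanged. -/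
theorem Induces.degrees_coboundaryLie (hB : Induces ev ev br B) (hP : IsFibration ev)
    (hr : IsConstantTensor ev r R) (a : P) :
    TensorProduct.map (ev (-q)) (ev (-p)) (coboundaryLie br r a)
        = LinearMap.rTensor E (B (α + β) p (ev (α + β) a)) R
          + LinearMap.lTensor E (B (α + β) q (ev (α + β) a)) R ∧
      TensorProduct.map (ev (α + p)) (ev (-p)) (coboundaryLie br r a)
        = LinearMap.rTensor E (B α p (ev α a)) R
          + LinearMap.lTensor E (B α (β + q) (ev α a)) R ∧
      TensorProduct.map (ev (-q)) (ev (α + q)) (coboundaryLie br r a)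
        = LinearMap.rTensor E (B α (β + p) (ev α a)) R
          + LinearMap.lTensor E (B α q (ev α a)) R ∧
      TensorProduct.map (ev (β + p)) (ev (-p)) (coboundaryLie br r a)
        = LinearMap.rTensor E (B β p (ev β a)) R
          + LinearMap.lTensor E (B β (α + q) (ev β a)) R ∧
      TensorProduct.map (ev (-q)) (ev (β + q)) (coboundaryLie br r a)
        = LinearMap.rTensor E (B β (α + p) (ev β a)) R
          + LinearMap.lTensor E (B β q (ev β a)) R := by
  refine ⟨?_, ?_, ?_, ?_, ?_⟩ <;> refine hB.map_coboundaryLie hP hr ?_ ?_ ?_ a <;>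
    first | ring1 | linear_combination hsum | linear_combination -hsum

theorem Induces.degrees_coboundaryMul (hM : Induces ev ev mu M) (hP : IsFibration ev)
    (hr : IsConstantTensor ev r R) (a : P) :
    TensorProduct.map (ev (-q)) (ev (-p)) (coboundaryMul mu r a)
        = LinearMap.lTensor E (M (α + β) q (ev (α + β) a)) R
          - LinearMap.rTensor E (M (α + β) p (ev (α + β) a)) R ∧
      TensorProduct.map (ev (α + p)) (ev (-p)) (coboundaryMul mu r a)
        = LinearMap.lTensor E (M α (β + q) (ev α a)) R
          - LinearMap.rTensor E (M α p (ev α a)) R ∧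
      TensorProduct.map (ev (-q)) (ev (α + q)) (coboundaryMul mu r a)
        = LinearMap.lTensor E (M α q (ev α a)) R
          - LinearMap.rTensor E (M α (β + p) (ev α a)) R ∧
      TensorProduct.map (ev (β + p)) (ev (-p)) (coboundaryMul mu r a)
        = LinearMap.lTensor E (M β (α + q) (ev β a)) R
          - LinearMap.rTensor E (M β p (ev β a)) R ∧
      TensorProduct.map (ev (-q)) (ev (β + q)) (coboundaryMul mu r a)
        = LinearMap.lTensor E (M β q (ev β a)) R
          - LinearMap.rTensor E (M β (α + p) (ev β a)) R := by
  refine ⟨?_, ?_, ?_, ?_, ?_⟩ <;> refine hM.map_coboundaryMul hP hr ?_ ?_ ?_ a <;>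
    first | ring1 | linear_combination hsum | linear_combination -hsum

end Degrees

variable [Infinite k]

/-- The coalgebra part comes from duality. On fibres each compatibility condition is linear in `R`.
On a pure tensor `u ⊗ v`, terms acting on both factors cancel, up to commuting multiplications, and
terms acting on one factor are matched by a Poisson identity. -/
theorem IsPoissonFam.isCoboundaryPoissonConfBialg (h : IsPoissonFam B M) (hP : IsFibration ev)
    (hB : Induces ev ev br B) (hM : Induces ev ev mu M) (hωB : IsCocycleFor ω B)
    (hωM : IsCocycleFor ω M) (hskew : ∀ u v, ω u v = -ω v u) (hsep : Separating ω)
    (hR : IsInverseTensor ω R) (hr : IsConstantTensor ev r R) :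
    IsCoboundaryPoissonConfBialg br mu (coboundaryLie br r) (coboundaryMul mu r) := by
  have hconf := h.isPoissonConf hP hB hM
  have hco := h.isPoissonConfCoalg hskew hP hsep
    (hB.isDualTo_coboundaryLie hP hr hR hωB h.skew) (hM.isDualTo_coboundaryMul hP hr hR hωM h.comm)
  -- Commutativity identifies right and left multiplications.
  have hopp : opp mu = mu := by
    ext1 a; ext1 b; exact (hconf.comm a b).symm
  have hRskew : TensorProduct.comm k E E R = -R := by
    refine (hsep.pairT hsep).ext fun p => ?_
    rw [pairT_comm, map_neg, hR.left, hR.left, hskew]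
  refine ⟨⟨hconf, hco, ⟨hconf.lie, hco.lie, fun l a b => ?_⟩,
    ⟨hconf.assoc, hco.assoc, fun l a b => ?_, fun l a b => ?_⟩, fun l a b => ?_,
    fun l a b => ?_⟩, r, rfl, rfl⟩
  · revert l
    refine hP.ext_tensor_of_degrees fun α β p q hsum => ?_
    obtain ⟨-, -, -, d1, d2⟩ := hB.degrees_coboundaryLie hsum hP hr b
    obtain ⟨-, d3, d4, -, -⟩ := hB.degrees_coboundaryLie hsum hP hr a
    rw [(hB.degrees_coboundaryLie hsum hP hr _).1, map_sub, map_add, map_add,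
      hB.degrees_actL hsum, hB.degrees_actR hsum, hB.degrees_actNegL hsum hP,
      hB.degrees_actNegR hsum hP, d1, d2, d3, d4, hB.apply]
    -- From here the identity holds for an arbitrary tensor `R`; dropping what is known about it
    -- allows induction down to pure tensors.
    clear d1 d2 d3 d4 hr hR hRskew
    induction R using TensorProduct.induction_on with
    | zero => simp
    | add x y hx hy =>
      simp only [map_add] at hx hy ⊢
      linear_combination (norm := module) hx + hy
    | tmul u v =>
      simp only [map_add, LinearMap.rTensor_tmul, LinearMap.lTensor_tmul, h.jacobi α β p,
        h.jacobi α β q, TensorProduct.add_tmul, TensorProduct.tmul_add]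
      abel
  · rw [hopp]
    revert l
    refine hP.ext_tensor_of_degrees fun α β p q hsum => ?_
    obtain ⟨-, -, -, -, d2⟩ := hM.degrees_coboundaryMul hsum hP hr b
    obtain ⟨-, d3, -, -, -⟩ := hM.degrees_coboundaryMul hsum hP hr a
    rw [(hM.degrees_coboundaryMul hsum hP hr _).1, map_add, hM.degrees_actR hsum,
      hM.degrees_actNegL hsum hP, d2, d3, hM.apply]
    clear d2 d3 hr hR hRskew
    induction R using TensorProduct.induction_on with
    | zero => simp
    | add x y hx hy =>
      simp only [map_add, map_sub] at hx hy ⊢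
      linear_combination (norm := module) hx + hy
    | tmul u v =>
      simp only [map_sub, LinearMap.rTensor_tmul, LinearMap.lTensor_tmul, h.assoc α β,
        h.mul_left_comm α β p]
      abel
  · rw [hopp]
    revert l
    refine hP.ext_tensor_of_degrees fun α β p q hsum => ?_
    -- The flip exchanges the two factors, so the terms under it are evaluated with `p` and `q`
    -- interchanged.
    have hsum' : α + β + q + p = 0 := by linear_combination hsum
    obtain ⟨-, d1, d2, -, -⟩ := hM.degrees_coboundaryMul hsum hP hr a
    obtain ⟨-, -, -, d3, d4⟩ := hM.degrees_coboundaryMul hsum' hP hr b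
    rw [map_add, map_sub, comm_map, map_sub, map_zero, hM.degrees_actNegL hsum hP,
      hM.degrees_actNegR hsum hP, hM.degrees_actL hsum', hM.degrees_actR hsum', d1, d2, d3, d4]
    -- Moving the flip inward onto `R` gives the sign that makes the two halves cancel, since
    -- multiplications commute.
    simp only [map_sub, comm_rTensor, comm_lTensor, hRskew, map_neg]
    clear d1 d2 d3 d4 hr hR hRskew
    induction R using TensorProduct.induction_on with
    | zero => simp
    | add x y hx hy =>
      simp only [map_add] at hx hy ⊢
      linear_combination (norm := module) hx + hy
    | tmul u v =>
      simp only [LinearMap.rTensor_tmul, LinearMap.lTensor_tmul, h.mul_left_comm β α q,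
        h.mul_left_comm β α p]
      abel
  · revert l
    refine hP.ext_tensor_of_degrees fun α β p q hsum => ?_
    obtain ⟨-, -, -, d1, -⟩ := hB.degrees_coboundaryLie hsum hP hr b
    obtain ⟨-, d2, -, -, -⟩ := hB.degrees_coboundaryLie hsum hP hr a
    obtain ⟨-, -, -, -, d3⟩ := hM.degrees_coboundaryMul hsum hP hr b
    obtain ⟨-, -, d4, -, -⟩ := hM.degrees_coboundaryMul hsum hP hr a
    rw [(hB.degrees_coboundaryLie hsum hP hr _).1, map_add, map_add, map_add,
      hM.degrees_actL hsum, hM.degrees_actNegL hsum hP, hB.degrees_actR hsum,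
      hB.degrees_actNegR hsum hP, d1, d2, d3, d4, hM.apply]
    clear d1 d2 d3 d4 hr hR hRskew
    induction R using TensorProduct.induction_on with
    | zero => simp
    | add x y hx hy =>
      simp only [map_add, map_sub] at hx hy ⊢
      linear_combination (norm := module) hx + hy
    | tmul u v =>
      -- The second leg contains `[a, bv] + [b, av]`, whereas `[ab, v]` expands to `a[b, v] + b[a,
      -- v]`.
      have hs := congrArg (fun w => u ⊗ₜ[k] w) (h.leibniz_symm α β q (ev α a) (ev β b) v)
      simp only [TensorProduct.tmul_add] at hs
      simp only [map_add, map_sub, LinearMap.rTensor_tmul, LinearMap.lTensor_tmul,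
        h.leibniz_left α β p, h.leibniz_left α β q, TensorProduct.add_tmul,
        TensorProduct.tmul_add]
      linear_combination (norm := module) -hs
  · revert l
    refine hP.ext_tensor_of_degrees fun α β p q hsum => ?_
    obtain ⟨-, -, -, d1, d2⟩ := hM.degrees_coboundaryMul hsum hP hr b
    obtain ⟨-, d3, d4, -, -⟩ := hB.degrees_coboundaryLie hsum hP hr a
    rw [(hM.degrees_coboundaryMul hsum hP hr _).1, map_add, map_sub, map_add,
      hB.degrees_actL hsum, hB.degrees_actR hsum, hM.degrees_actNegL hsum hP,
      hM.degrees_actNegR hsum hP, d1, d2, d3, d4, hB.apply]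
    clear d1 d2 d3 d4 hr hR hRskew
    induction R using TensorProduct.induction_on with
    | zero => simp
    | add x y hx hy =>
      simp only [map_add, map_sub] at hx hy ⊢
      linear_combination (norm := module) hx + hy
    | tmul u v =>
      simp only [map_add, map_sub, LinearMap.rTensor_tmul, LinearMap.lTensor_tmul,
        h.leibniz α β p, h.leibniz α β q, TensorProduct.add_tmul, TensorProduct.tmul_add]
      abel

end Coboundaries

/-! ## The Poisson conformal Yang-Baxter equation -/

section Contractions

variable {k : Type*} [Field k] {V W : Type*} [AddCommGroup V] [Module k V]
  [AddCommGroup W] [Module k W]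

/-- `v ⊗ w ↦ φ(v)w`. -/
def contrL (φ : V →ₗ[k] k) : V ⊗[k] W →ₗ[k] W :=
  (TensorProduct.lid k W).toLinearMap ∘ₗ LinearMap.rTensor W φ

/-- `v ⊗ w ↦ ψ(w)v`. -/
def contrR (ψ : W →ₗ[k] k) : V ⊗[k] W →ₗ[k] V :=
  (TensorProduct.rid k V).toLinearMap ∘ₗ LinearMap.lTensor V ψ

theorem contrL_tmul (φ : V →ₗ[k] k) (v : V) (w : W) : contrL φ (v ⊗ₜ[k] w) = φ v • w := by
  simp [contrL]

theorem contrR_tmul (ψ : W →ₗ[k] k) (v : V) (w : W) : contrR ψ (v ⊗ₜ[k] w) = ψ w • v := by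
  simp [contrR]

theorem pairT_eq_contrL (φ : V →ₗ[k] k) (ψ : W →ₗ[k] k) (t : V ⊗[k] W) :
    pairT φ ψ t = ψ (contrL φ t) := by
  induction t using TensorProduct.induction_on with
  | zero => simp
  | add x y hx hy => simp only [map_add, hx, hy]
  | tmul v w => simp [pairT_tmul, contrL_tmul]

theorem pairT_eq_contrR (φ : V →ₗ[k] k) (ψ : W →ₗ[k] k) (t : V ⊗[k] W) :
    pairT φ ψ t = φ (contrR ψ t) := by
  induction t using TensorProduct.induction_on with
  | zero => simp
  | add x y hx hy => simp only [map_add, hx, hy]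
  | tmul v w => simp [pairT_tmul, contrR_tmul, mul_comm]

/-- Functionals separate the points of `V`, so the defining pairings of the inverse tensor determine
the contracted vector. -/
theorem IsInverseTensor.contrL_eq {ω : V →ₗ[k] V →ₗ[k] k} {R : V ⊗[k] V}
    (h : IsInverseTensor ω R) (v : V) : contrL (ω v) R = v := by
  rw [← sub_eq_zero, ← Module.forall_dual_apply_eq_zero_iff k]
  intro φ
  rw [map_sub, ← pairT_eq_contrL, h.left, sub_self]

theorem IsInverseTensor.contrR_eq {ω : V →ₗ[k] V →ₗ[k] k} {R : V ⊗[k] V}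
    (h : IsInverseTensor ω R) (v : V) : contrR (ω v) R = -v := by
  rw [← sub_eq_zero, ← Module.forall_dual_apply_eq_zero_iff k]
  intro φ
  rw [map_sub, ← pairT_eq_contrR, h.right, map_neg, sub_self]

theorem pairT_smul_left (c : k) (φ : V →ₗ[k] k) (ψ : W →ₗ[k] k) :
    pairT (c • φ) ψ = c • pairT φ ψ := by
  rw [pairT, TensorProduct.map_smul_left, LinearMap.comp_smul, pairT]

theorem pairT_smul_right (c : k) (φ : V →ₗ[k] k) (ψ : W →ₗ[k] k) :
    pairT φ (c • ψ) = c • pairT φ ψ := by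
  rw [pairT, TensorProduct.map_smul_right, LinearMap.comp_smul, pairT]

/-- Linear maps out of `(V ⊗ V) ⊗ (V ⊗ V)` may be compared on pure tensors. -/
theorem ext_tmul_tmul {f : (V ⊗[k] V) ⊗[k] (V ⊗[k] V) →ₗ[k] k}
    {g : (V ⊗[k] V) →ₗ[k] (V ⊗[k] V) →ₗ[k] k}
    (h : ∀ a b c d : V, f ((a ⊗ₜ b) ⊗ₜ (c ⊗ₜ d)) = g (a ⊗ₜ b) (c ⊗ₜ d)) (t u : V ⊗[k] V) :
    f (t ⊗ₜ u) = g t u := by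
  have : (TensorProduct.mk k _ _).compr₂ f = g := by
    ext a b c d
    exact h a b c d
  exact LinearMap.congr_fun (LinearMap.congr_fun this t) u

end Contractions

/-! ### Yang-Baxter tensors on fibres of total degree zero. -/

section YangBaxter

variable {k : Type*} [Field k] {P E : Type*}
  [AddCommGroup P] [Module k P] [AddCommGroup E] [Module k E] {ev : k → P →ₗ[k] E}

section Terms

variable {β : LAct k P P} {N : E →ₗ[k] E →ₗ[k] E} {φ ψ χ : E →ₗ[k] k} {x y z p q : k}

/-- On the chosen fibres `T` is the scalar `τ`. The two legs not multiplied are contracted with `φ`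
and `χ`, so each copy of the tensor becomes a single vector before `N` multiplies them. -/
theorem pairT_ybSecond {T : Module.End k (P ⊗[k] (P ⊗[k] P))} {τ : k}
    (hT : ∀ t, pairT (φ ∘ₗ ev x) (pairT (ψ ∘ₗ ev y) (χ ∘ₗ ev z)) (T t)
      = τ • pairT (φ ∘ₗ ev x) (pairT (ψ ∘ₗ ev y) (χ ∘ₗ ev z)) t)
    (hN : ∀ c b, ev y (lm β τ c b) = N (ev q c) (ev p b)) (t u : P ⊗[k] P) :
    pairT (φ ∘ₗ ev x) (pairT (ψ ∘ₗ ev y) (χ ∘ₗ ev z)) (ybSecond β T (t ⊗ₜ u))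
      = ψ (N (contrR χ (TensorProduct.map (ev q) (ev z) u))
        (contrL φ (TensorProduct.map (ev x) (ev p) t))) := by
  refine ext_tmul_tmul (f := pairT (φ ∘ₗ ev x) (pairT (ψ ∘ₗ ev y) (χ ∘ₗ ev z)) ∘ₗ ybSecond β T)
    (g := (N.flip.compr₂ ψ).compl₁₂ (contrL φ ∘ₗ TensorProduct.map (ev x) (ev p))
      (contrR χ ∘ₗ TensorProduct.map (ev q) (ev z))) (fun a b c d => ?_) t u
  rw [LinearMap.comp_apply, ybSecond, LinearMap.comp_apply, map_evalAt_of_eigen _ _ τ hT,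
    LinearMap.comp_apply, evalSc_onRight]
  simp only [LinearMap.comp_apply, LinearEquiv.coe_coe, TensorProduct.assoc_tmul,
    LinearMap.lTensor_tmul, TensorProduct.assoc_symm_tmul, evalSc_onLeft, LinearMap.rTensor_tmul,
    pairT_tmul, TensorProduct.lift.tmul, LinearMap.flip_apply,
    LinearMap.compl₁₂_apply, LinearMap.compr₂_apply, TensorProduct.map_tmul, contrR_tmul,
    contrL_tmul, map_smul, LinearMap.smul_apply, smul_eq_mul, ← hN, lm]
  ring

theorem pairT_ybThird {T : Module.End k (P ⊗[k] (P ⊗[k] P))} {τ : k}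
    (hT : ∀ t, pairT (φ ∘ₗ ev x) (pairT (ψ ∘ₗ ev y) (χ ∘ₗ ev z)) (T t)
      = τ • pairT (φ ∘ₗ ev x) (pairT (ψ ∘ₗ ev y) (χ ∘ₗ ev z)) t)
    (hN : ∀ b d, ev z (lm β τ b d) = N (ev p b) (ev q d)) (t u : P ⊗[k] P) :
    pairT (φ ∘ₗ ev x) (pairT (ψ ∘ₗ ev y) (χ ∘ₗ ev z)) (ybThird β T (t ⊗ₜ u))
      = χ (N (contrL φ (TensorProduct.map (ev x) (ev p) t))
        (contrL ψ (TensorProduct.map (ev y) (ev q) u))) := by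
  refine ext_tmul_tmul (f := pairT (φ ∘ₗ ev x) (pairT (ψ ∘ₗ ev y) (χ ∘ₗ ev z)) ∘ₗ ybThird β T)
    (g := (N.compr₂ χ).compl₁₂ (contrL φ ∘ₗ TensorProduct.map (ev x) (ev p))
      (contrL ψ ∘ₗ TensorProduct.map (ev y) (ev q))) (fun a b c d => ?_) t u
  rw [LinearMap.comp_apply, ybThird, LinearMap.comp_apply, map_evalAt_of_eigen _ _ τ hT,
    LinearMap.comp_apply, evalSc_onRight]
  simp only [LinearMap.comp_apply, LinearEquiv.coe_coe, TensorProduct.assoc_tmul,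
    TensorProduct.tensorTensorTensorComm_tmul, LinearMap.lTensor_tmul, evalSc_onRight,
    pairT_tmul, TensorProduct.lift.tmul,
    LinearMap.compl₁₂_apply, LinearMap.compr₂_apply, TensorProduct.map_tmul,
    contrL_tmul, map_smul, LinearMap.smul_apply, smul_eq_mul, ← hN, lm]
  ring

end Terms

variable [Module k[X] P] [IsScalarTower k k[X] P]

theorem IsFibration.comp_del (hP : IsFibration ev) (φ : E →ₗ[k] k) (x : k) :
    (φ ∘ₗ ev x) ∘ₗ PConf.del k P = x • (φ ∘ₗ ev x) := by
  ext a
  simp [hP.del]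

section Eigen

variable (hP : IsFibration ev) (φ ψ χ : E →ₗ[k] k) (x y z : k) (t : P ⊗[k] (P ⊗[k] P))

include hP

theorem pairT_delA : pairT (φ ∘ₗ ev x) (pairT (ψ ∘ₗ ev y) (χ ∘ₗ ev z)) (delA k P t)
    = x • pairT (φ ∘ₗ ev x) (pairT (ψ ∘ₗ ev y) (χ ∘ₗ ev z)) t := by
  rw [delA, pairT_rTensor, hP.comp_del, pairT_smul_left, LinearMap.smul_apply]

theorem pairT_delB : pairT (φ ∘ₗ ev x) (pairT (ψ ∘ₗ ev y) (χ ∘ₗ ev z)) (delB k P t)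
    = y • pairT (φ ∘ₗ ev x) (pairT (ψ ∘ₗ ev y) (χ ∘ₗ ev z)) t := by
  have : pairT (ψ ∘ₗ ev y) (χ ∘ₗ ev z) ∘ₗ LinearMap.rTensor P (del k P)
      = y • pairT (ψ ∘ₗ ev y) (χ ∘ₗ ev z) := by
    refine LinearMap.ext fun u => ?_
    rw [LinearMap.comp_apply, pairT_rTensor, hP.comp_del, pairT_smul_left]
  rw [delB, pairT_lTensor, this, pairT_smul_right, LinearMap.smul_apply]

theorem pairT_delC : pairT (φ ∘ₗ ev x) (pairT (ψ ∘ₗ ev y) (χ ∘ₗ ev z)) (delC k P t)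
    = z • pairT (φ ∘ₗ ev x) (pairT (ψ ∘ₗ ev y) (χ ∘ₗ ev z)) t := by
  have : pairT (ψ ∘ₗ ev y) (χ ∘ₗ ev z) ∘ₗ LinearMap.lTensor P (del k P)
      = z • pairT (ψ ∘ₗ ev y) (χ ∘ₗ ev z) := by
    refine LinearMap.ext fun u => ?_
    rw [LinearMap.comp_apply, pairT_lTensor, hP.comp_del, pairT_smul_right]
  rw [delC, pairT_lTensor, this, pairT_smul_right, LinearMap.smul_apply]

end Eigen

theorem pairT_ybFirst {β : LAct k P P} {N : E →ₗ[k] E →ₗ[k] E} {φ ψ χ : E →ₗ[k] k}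
    {x y z p q : k} (hP : IsFibration ev)
    (hN : ∀ a c, ev x (lm β y a c) = N (ev p a) (ev q c)) (t u : P ⊗[k] P) :
    pairT (φ ∘ₗ ev x) (pairT (ψ ∘ₗ ev y) (χ ∘ₗ ev z)) (ybFirst β (t ⊗ₜ u))
      = φ (N (contrR ψ (TensorProduct.map (ev p) (ev y) t))
        (contrR χ (TensorProduct.map (ev q) (ev z) u))) := by
  refine ext_tmul_tmul (f := pairT (φ ∘ₗ ev x) (pairT (ψ ∘ₗ ev y) (χ ∘ₗ ev z)) ∘ₗ ybFirst β)
    (g := (N.compr₂ φ).compl₁₂ (contrR ψ ∘ₗ TensorProduct.map (ev p) (ev y))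
      (contrR χ ∘ₗ TensorProduct.map (ev q) (ev z))) (fun a b c d => ?_) t u
  rw [LinearMap.comp_apply, ybFirst, LinearMap.comp_apply,
    map_evalAt_of_eigen _ _ y (pairT_delB hP φ ψ χ x y z), LinearMap.comp_apply, evalSc_onLeft]
  simp only [LinearEquiv.coe_coe, TensorProduct.tensorTensorTensorComm_tmul,
    LinearMap.rTensor_tmul, pairT_tmul, LinearMap.comp_apply, TensorProduct.lift.tmul,
    LinearMap.compl₁₂_apply, LinearMap.compr₂_apply, TensorProduct.map_tmul, contrR_tmul, map_smul,
    LinearMap.smul_apply, smul_eq_mul, ← hN, lm]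
  ring

/-- Every element of `P ⊗ P ⊗ P` is congruent modulo `∂ ⊗ I ⊗ I + I ⊗ ∂ ⊗ I + I ⊗ I ⊗ ∂` to one
whose first factors are generators of `P`. -/
theorem exists_sub_mem_range_delThree {s : E →ₗ[k] P}
    (hs : Submodule.span k[X] (Set.range s) = ⊤) (t : P ⊗[k] (P ⊗[k] P)) :
    ∃ u : E ⊗[k] (P ⊗[k] P),
      t - LinearMap.rTensor (P ⊗[k] P) s u ∈ LinearMap.range (delThree k P) := by
  have hadd : ∀ t t', (∃ u : E ⊗[k] (P ⊗[k] P),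
      t - LinearMap.rTensor (P ⊗[k] P) s u ∈ LinearMap.range (delThree k P)) →
      (∃ u : E ⊗[k] (P ⊗[k] P),
        t' - LinearMap.rTensor (P ⊗[k] P) s u ∈ LinearMap.range (delThree k P)) →
      ∃ u : E ⊗[k] (P ⊗[k] P),
        t + t' - LinearMap.rTensor (P ⊗[k] P) s u ∈ LinearMap.range (delThree k P) := by
    rintro t t' ⟨u, hu⟩ ⟨u', hu'⟩
    refine ⟨u + u', ?_⟩
    rw [map_add, add_sub_add_comm]
    exact add_mem hu hu'
  have hdel : ∀ a : P, (∀ w : P ⊗[k] P, ∃ u : E ⊗[k] (P ⊗[k] P),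
      a ⊗ₜ w - LinearMap.rTensor (P ⊗[k] P) s u ∈ LinearMap.range (delThree k P)) →
      ∀ w : P ⊗[k] P, ∃ u : E ⊗[k] (P ⊗[k] P),
        del k P a ⊗ₜ w - LinearMap.rTensor (P ⊗[k] P) s u ∈ LinearMap.range (delThree k P) := by
    intro a ha w
    -- Modulo the image of `∂^{⊗3}`, `∂a ⊗ w` equals `-a ⊗ ∂^{⊗2} w`, which removes one `∂` from the
    -- first factor.
    obtain ⟨u, hu⟩ := ha (delTwo k P w)
    refine ⟨-u, ?_⟩
    have h3 : delThree k P (a ⊗ₜ w) = del k P a ⊗ₜ w + a ⊗ₜ delTwo k P w := by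
      simp [delThree, delA, delB, delC, delTwo, TensorProduct.tmul_add, add_assoc]
    have : del k P a ⊗ₜ w - LinearMap.rTensor (P ⊗[k] P) s (-u) = delThree k P (a ⊗ₜ w)
        - (a ⊗ₜ delTwo k P w - LinearMap.rTensor (P ⊗[k] P) s u) := by
      rw [h3, map_neg]
      abel
    rw [this]
    exact sub_mem ⟨_, rfl⟩ hu
  induction t using TensorProduct.induction_on with
  | zero => exact ⟨0, by simp⟩
  | add t t' ht ht' => exact hadd t t' ht ht'
  | tmul a w =>
    have ha : a ∈ Submodule.span k[X] (Set.range s) := hs ▸ Submodule.mem_top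
    induction ha using Submodule.span_induction generalizing w with
    | mem a ha =>
      obtain ⟨e, rfl⟩ := ha
      exact ⟨e ⊗ₜ w, by simp⟩
    | zero => exact ⟨0, by simp⟩
    | add a b _ _ ha hb =>
      rw [TensorProduct.add_tmul]
      exact hadd _ _ (ha w) (hb w)
    | smul f a _ ha =>
      induction f using Polynomial.induction_on generalizing w with
      | C c =>
        obtain ⟨u, hu⟩ := ha w
        refine ⟨c • u, ?_⟩
        rw [← mul_one (Polynomial.C c), ← Polynomial.smul_eq_C_mul, smul_assoc, one_smul,
          ← TensorProduct.smul_tmul', map_smul, ← smul_sub]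
        exact Submodule.smul_mem _ c hu
      | add f g hf hg =>
        rw [add_smul, TensorProduct.add_tmul]
        exact hadd _ _ (hf w) (hg w)
      | monomial n c hn =>
        rw [pow_succ', mul_left_comm, mul_smul]
        exact hdel _ hn w

/-- Modulo the image, the first factor of `t` may be moved into the generators `s(E)`. Elements of
`s(E)` have the same value in every fibre, so the remaining tensor `u` is determined by arbitrary
fibres `y`, `z` of the other two factors with the first at `-(y + z)`; there the image of `∂^{⊗3}`
vanishes. -/
theorem mem_range_delThree (hP : IsFibration ev) {s : E →ₗ[k] P}
    (hs : Submodule.span k[X] (Set.range s) = ⊤) (hev : ∀ α e, ev α (s e) = e)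
    {ω : E →ₗ[k] E →ₗ[k] k} (hω : Separating ω) {t : P ⊗[k] (P ⊗[k] P)}
    (h : ∀ x y z, x + y + z = 0 → ∀ u v w,
      pairT (ω u ∘ₗ ev x) (pairT (ω v ∘ₗ ev y) (ω w ∘ₗ ev z)) t = 0) :
    t ∈ LinearMap.range (delThree k P) := by
  obtain ⟨u, d, hd⟩ := exists_sub_mem_range_delThree hs t
  suffices hu : u = 0 by
    rw [hu, map_zero, sub_zero] at hd
    exact ⟨d, hd⟩
  refine (hω.pairT ((hP.sep.comp hω).pairT (hP.sep.comp hω))) u ?_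
  rintro ⟨v, ⟨y, w⟩, ⟨z, w'⟩⟩
  have h1 := h (-(y + z)) y z (by ring) v w w'
  have h2 := congrArg (pairT (ω v ∘ₗ ev (-(y + z))) (pairT (ω w ∘ₗ ev y) (ω w' ∘ₗ ev z))) hd
  rw [map_sub, h1, delThree, LinearMap.add_apply, LinearMap.add_apply, map_add, map_add,
    pairT_delA hP, pairT_delB hP, pairT_delC hP, ← add_smul, ← add_smul,
    show -(y + z) + y + z = 0 by ring, zero_smul, zero_sub, eq_comm, neg_eq_zero,
    pairT_rTensor] at h2
  have hcomp : (ω v ∘ₗ ev (-(y + z))) ∘ₗ s = ω v := LinearMap.ext fun e => by simp [hev]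
  rwa [hcomp] at h2

variable {br mu : LAct k P P} {B M : BilinFam k E E} {ω : E →ₗ[k] E →ₗ[k] k} {r : P ⊗[k] P}
  {R : E ⊗[k] E}

/-- After pairing with `ω u`, `ω v`, `ω w` in total degree zero, contractions of `R` return these
vectors up to sign. The three terms become `ω(u, vw)`, `ω(v, wu)` and `ω(w, uv)`, so the tensor
pairs to the cyclic sum. -/
theorem isPCYBESolution_of_isCocycleFor (hP : IsFibration ev) {s : E →ₗ[k] P}
    (hs : Submodule.span k[X] (Set.range s) = ⊤) (hev : ∀ α e, ev α (s e) = e)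
    (hB : Induces ev ev br B) (hM : Induces ev ev mu M) (hωB : IsCocycleFor ω B)
    (hωM : IsCocycleFor ω M) (hskew : ∀ α β a b, B α β a b = -B β α b a)
    (hsep : Separating ω) (hR : IsInverseTensor ω R)
    (hr : IsConstantTensor ev r R) : IsPCYBESolution br mu r where
  lie := mem_range_delThree hP hs hev hsep fun x y z hxyz u v w => by
    rw [lieYB, map_sub, map_sub,
      pairT_ybFirst hP (N := B (-y) (-z)) (p := -y) (q := -z)
        (fun _ _ => hB.lm (neg_neg y).symm (by linear_combination hxyz) _ _),
      pairT_ybSecond (pairT_delC hP _ _ _ x y z) (N := B (-z) (-x)) (p := -x) (q := -z)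
        (fun _ _ => hB.lm (neg_neg z).symm (by linear_combination hxyz) _ _),
      pairT_ybThird (pairT_delB hP _ _ _ x y z) (N := (B (-y) (-x)).flip) (p := -x) (q := -y)
        (fun _ _ => hB.lm (neg_neg y).symm (by linear_combination hxyz) _ _),
      hr _ _ (neg_add_cancel y), hr _ _ (neg_add_cancel z), hr _ _ (add_neg_cancel x),
      hr _ _ (add_neg_cancel y)]
    have h1 := hωB (-x) (-y) (-z) u v w (by linear_combination -hxyz)
    simp only [hR.contrL_eq, hR.contrR_eq, map_neg, LinearMap.neg_apply, LinearMap.flip_apply,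
      hskew (-y) (-x)]
    linear_combination h1
  mul := mem_range_delThree hP hs hev hsep fun x y z hxyz u v w => by
    rw [mulYB, map_add, map_sub,
      pairT_ybFirst hP (N := M (-y) (-z)) (p := -y) (q := -z)
        (fun _ _ => hM.lm (neg_neg y).symm (by linear_combination hxyz) _ _),
      pairT_ybSecond (τ := z) (N := M (-z) (-x)) (p := -x) (q := -z) ?_
        (fun _ _ => hM.lm (neg_neg z).symm (by linear_combination hxyz) _ _),
      pairT_ybThird (pairT_delA hP _ _ _ x y z) (N := M (-x) (-y)) (p := -x) (q := -y)
        (fun _ _ => hM.lm (neg_neg x).symm (by linear_combination hxyz) _ _),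
      hr _ _ (neg_add_cancel y), hr _ _ (neg_add_cancel z), hr _ _ (add_neg_cancel x),
      hr _ _ (add_neg_cancel y)]
    · have h1 := hωM (-x) (-y) (-z) u v w (by linear_combination -hxyz)
      simp only [hR.contrL_eq, hR.contrR_eq, map_neg, LinearMap.neg_apply]
      linear_combination h1
    -- The substitution `-∂^{⊗2} ⊗ I` is the scalar `-(x + y)`, which is `z` because the total
    -- degree is zero.
    · intro t
      rw [LinearMap.neg_apply, LinearMap.add_apply, map_neg, map_add, pairT_delA hP,
        pairT_delB hP, ← add_smul, ← neg_smul]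
      congr 1
      linear_combination -hxyz

end YangBaxter

/-! ## The double of a pre-PGD-algebra -/

section Double

variable {k : Type*} [Field k] {A : Type*} [AddCommGroup A] [Module k A] {n : ℕ}

/-- The fibres of `P ⊕ P^{*c}` for `P = k[∂] ⊗ A`. -/
def evHat (k A : Type*) [Field k] [AddCommGroup A] [Module k A] (α : k) :
    HatMod k A →ₗ[k] A × (A →ₗ[k] k) :=
  (evFree k A α).prodMap (evDual k A α)

theorem isFibration_evHat [Infinite k] : IsFibration (evHat k A) :=
  isFibration_evFree.prodMap isFibration_evDual

/-- The generators of `P ⊕ P^{*c}`. -/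
def inHat (k A : Type*) [Field k] [AddCommGroup A] [Module k A] :
    A × (A →ₗ[k] k) →ₗ[k] HatMod k A :=
  (inA k A).prodMap
    { toFun := inDual
      map_add' := fun f g => by
        refine ConfDual.ext fun v => ?_
        induction v using TensorProduct.induction_on with
        | zero => simp
        | add v w hv hw => simp only [map_add, hv, hw]
        | tmul p a => simp [inDual_tmul, add_smul]
      map_smul' := fun c f => by
        refine ConfDual.ext fun v => ?_
        induction v using TensorProduct.induction_on with
        | zero => simp
        | add v w hv hw => simp only [map_add, hv, hw]
        | tmul p a => simp [inDual_tmul, mul_smul] }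

theorem inHat_apply (p : A × (A →ₗ[k] k)) : inHat k A p = (inA k A p.1, inDual p.2) := rfl

theorem evHat_inHat (α : k) (p : A × (A →ₗ[k] k)) : evHat k A α (inHat k A p) = p :=
  Prod.ext (evFree_inA α p.1) (evDual_inDual α p.2)

/-- A conformal functional is determined by its values on the basis of `A`. As `p(∂)` acts by
`p(-λ)`, the coefficients are these values with `λ` replaced by `-λ`. -/
theorem confDual_eq_sum (e : Module.Basis (Fin n) k A) (f : ConfDual k (FreeMod k A)) :
    f = ∑ i, (f.toLin (inA k A (e i))).comp (-Polynomial.X) • inDual (e.coord i) := by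
  refine ConfDual.ext fun v => ?_
  induction v using TensorProduct.induction_on with
  | zero => simp
  | add v w hv hw => rw [map_add, hv, hw, map_add]
  | tmul p a =>
    rw [ConfDual.toLin_tmul]
    conv_lhs => rw [← e.sum_repr a]
    simp only [map_sum, map_smul, LinearMap.sum_apply, ConfDual.smul_apply, inDual_tmul,
      Polynomial.comp_assoc, Polynomial.neg_comp, Polynomial.X_comp, neg_neg, Polynomial.comp_X,
      Finset.mul_sum, Module.Basis.coord_apply]
    refine Finset.sum_congr rfl fun i _ => ?_
    rw [mul_smul_comm, mul_smul_comm, mul_comm]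

theorem span_range_inHat [FiniteDimensional k A] :
    Submodule.span k[X] (Set.range (inHat k A)) = ⊤ := by
  refine eq_top_iff.mpr fun x _ => ?_
  have h1 : ∀ a : FreeMod k A,
      ((a, 0) : HatMod k A) ∈ Submodule.span k[X] (Set.range (inHat k A)) := by
    intro a
    induction a using TensorProduct.induction_on with
    | zero => exact zero_mem _
    | add a b ha hb => simpa using add_mem ha hb
    | tmul p a =>
      have : ((p ⊗ₜ[k] a, 0) : HatMod k A) = p • inHat k A (a, 0) := by
        rw [inHat_apply]
        ext1
        · simp [inA, TensorProduct.smul_tmul']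
        · simp [show inDual (0 : A →ₗ[k] k) = 0 from (Prod.ext_iff.mp (inHat k A).map_zero).2]
      rw [this]
      exact Submodule.smul_mem _ _ (Submodule.subset_span ⟨_, rfl⟩)
  have h2 : ∀ f : ConfDual k (FreeMod k A),
      ((0, f) : HatMod k A) ∈ Submodule.span k[X] (Set.range (inHat k A)) := by
    intro f
    have : ((0, f) : HatMod k A) = ∑ i,
        (f.toLin (inA k A (Module.finBasis k A i))).comp (-Polynomial.X)
          • inHat k A (0, (Module.finBasis k A).coord i) := by
      ext1
      · simp [Prod.fst_sum, inHat_apply]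
      · rw [Prod.snd_sum]
        exact confDual_eq_sum (Module.finBasis k A) f
    rw [this]
    exact sum_mem fun i _ => Submodule.smul_mem _ _ (Submodule.subset_span ⟨_, rfl⟩)
  simpa using add_mem (h1 x.1) (h2 x.2)

/-- The inverse of the symplectic form on `A ⊕ A*`. -/
def pairTensor (e : Module.Basis (Fin n) k A) :
    (A × (A →ₗ[k] k)) ⊗[k] (A × (A →ₗ[k] k)) :=
  ∑ i, ((e i, (0 : A →ₗ[k] k)) ⊗ₜ[k] ((0 : A), e.coord i)
    - ((0 : A), e.coord i) ⊗ₜ[k] (e i, (0 : A →ₗ[k] k)))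

theorem isConstantTensor_basisTensor (e : Module.Basis (Fin n) k A) :
    IsConstantTensor (evHat k A) (basisTensor e) (pairTensor e) := by
  intro x y _
  simp [basisTensor, pairTensor, evHat, evFree_inA, evDual_inDual]

theorem isInverseTensor_pairTensor (e : Module.Basis (Fin n) k A) :
    IsInverseTensor (pairForm k A) (pairTensor e) := by
  -- Both contraction formulas are the expansion of `v` in the basis formed by the `e i` and their
  -- duals.
  have hsum : ∀ (v : A × (A →ₗ[k] k)) (φ : A × (A →ₗ[k] k) →ₗ[k] k),
      φ v = ∑ i, (e.coord i v.1 * φ (e i, 0) + v.2 (e i) * φ (0, e.coord i)) := by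
    intro v φ
    have hv : v = ∑ i, (e.coord i v.1 • ((e i, 0) : A × (A →ₗ[k] k))
        + v.2 (e i) • ((0, e.coord i) : A × (A →ₗ[k] k))) := by
      ext1
      · simp [Prod.fst_sum, e.sum_repr]
      · rw [Prod.snd_sum]
        refine e.ext fun j => ?_
        simp
    conv_lhs => rw [hv]
    simp only [map_sum, map_add, map_smul, smul_eq_mul]
  constructor
  · intro v φ
    rw [hsum v φ, pairTensor, map_sum]
    refine Finset.sum_congr rfl fun i _ => ?_
    simp [pairT_tmul, pairForm_apply]
    ring
  · intro v φ
    rw [hsum v φ, pairTensor, map_sum, ← Finset.sum_neg_distrib]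
    refine Finset.sum_congr rfl fun i _ => ?_
    simp [pairT_tmul, pairForm_apply]
    ring

theorem isSkewSymm_basisTensor (e : Module.Basis (Fin n) k A) : IsSkewSymm (basisTensor e) := by
  simp [IsSkewSymm, basisTensor, map_sum]

end Double

end

end PConf

/-! ### The main theorem. -/

open PConf

theorem theorem5p21 {k : Type*} [Field k] [CharZero k] {A : Type*} [AddCommGroup A] [Module k A]
    [FiniteDimensional k A] (lhd rhd su dia : A →ₗ[k] A →ₗ[k] A)
    (hA : IsPrePGD lhd rhd su dia) {n : ℕ} (e : Module.Basis (Fin n) k A) :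
    IsPrePoissonConf (circProd lhd rhd dia) (succProd su) ∧
    IsPoissonConf (commutatorBr (circProd lhd rhd dia)) (symmMul (succProd su)) ∧
    IsPoissonRep (commutatorBr (circProd lhd rhd dia)) (symmMul (succProd su))
      (dualCirc lhd rhd dia) (-dualSucc su) ∧
    IsPoissonConf (hatBr lhd rhd dia) (hatMul su) ∧
    IsSkewSymm (basisTensor e) ∧
    IsPCYBESolution (hatBr lhd rhd dia) (hatMul su) (basisTensor e) ∧
    IsCoboundaryPoissonConfBialg (hatBr lhd rhd dia) (hatMul su)
      (coboundaryLie (hatBr lhd rhd dia) (basisTensor e))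
      (coboundaryMul (hatMul su) (basisTensor e)) := by
  have hpre := hA.isPrePoissonFam
  have hC := induces_circProd lhd rhd dia
  have hS := induces_succProd su
  have hB := hC.sub (hC.opp isFibration_evFree)
  have hM := hS.add (hS.opp isFibration_evFree)
  have hρ := hC.dualAct (circProd_sesqui lhd rhd dia)
  have hτ := (hS.dualAct (succProd_sesqui su)).neg
  have hhat := hpre.isPoissonFam.semi hpre.isPoissonRepFam_dual
  have hhatB : Induces (evHat k A) (evHat k A) (hatBr lhd rhd dia) _ :=
    hB.semiBr hρ isFibration_evDual
  have hhatM : Induces (evHat k A) (evHat k A) (hatMul su) _ :=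
    hM.semiMul hτ isFibration_evDual
  have hskew : ∀ u v, pairForm k A u v = -pairForm k A v u := fun u v => by
    rw [pairForm_apply, pairForm_apply, neg_sub]
  exact ⟨hpre.isPrePoissonConf isFibration_evFree hC hS,
    hpre.isPoissonFam.isPoissonConf isFibration_evFree hB hM,
    hpre.isPoissonRepFam_dual.isPoissonRep isFibration_evFree isFibration_evDual hB hM hρ hτ,
    hhat.isPoissonConf isFibration_evHat hhatB hhatM,
    isSkewSymm_basisTensor e,
    isPCYBESolution_of_isCocycleFor isFibration_evHat span_range_inHat evHat_inHat hhatB hhatM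
      (isCocycleFor_semiBrFam _) (isCocycleFor_semiMulFam _) hhat.skew pairForm_separating
      (isInverseTensor_pairTensor e) (isConstantTensor_basisTensor e),
    hhat.isCoboundaryPoissonConfBialg isFibration_evHat hhatB hhatM (isCocycleFor_semiBrFam _)
      (isCocycleFor_semiMulFam _) hskew pairForm_separating (isInverseTensor_pairTensor e)
      (isConstantTensor_basisTensor e)⟩
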